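/- Let $n\ge 1$ be an integer, $q\in\mathbb Z/4\mathbb Z$, and $s,\lambda\in\mathbb C$; if $n\ge 2$ assume $\lambda\neq 0$. Let $\|\cdot\|$ be the Euclidean norm and $\Delta_n$ the Laplacian in $y\in\mathbb R^n$, and write $\rho=\|y\|$. Let $$I''(q,-\tfrac n2,s)=\{F\in C^\infty(\mathbb R\times\mathbb R^n;\mathbb C)\ :\ F(\theta+j\pi,(-1)^jy)=i^{-jq}F(\theta,y)\ \text{for all } j\in\mathbb Z\},$$ $$\Omega''=\|y\|^2\left(4s\,\partial_\theta+4s^2\|y\|^2+\Delta_n\right).$$ The group $K=K_2\times O(n)$, where $K_2\cong\mathbb R/4\pi\mathbb Z$, acts by $((\alpha,u).F)(\theta,y)=F(\theta-\alpha,u^{-1}y)$, and $F$ is called $K$-finite if its $K$-translates span a finite-dimensional complex vector space. Let $\ker(\Omega''-2\lambda)_K$ be the space of $K$-finite $F\in I''(q,-\frac n2,s)$ with $\Omega''F=2\lambda F$. Let $\mathcal H_k(\mathbb R^n)$ be the space of complex harmonic polynomials on $\mathbb R^n$ that are homogeneous of degree $k$, and let ${}_1F_1(a,b,z)=\sum_{j\ge0}\frac{(a)_j}{(b)_j\,j!}z^j$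 be the confluent hypergeometric function of the first kind. Call $\lambda$ admissible if - $n=1$ and $\lambda=\frac12L(L-1)$ for some integer $L\ge0$ (a triangular number), or - $n\ge2$ and $\lambda\in A_n=\{l(n+2j)\ :\ l,j\in\mathbb Z,\ 1\le l\le j+1\}$. Call a pair of integers $(l,k)$ with $l,k\ge 0$ $\lambda$-admissible if $\lambda=l(2l+2k+n-2)$ and, in addition, $l\ge1$ when $n\ge2$, and $k\in\{0,1\}$ when $n=1$. (For $n=1$ the equation reads $\lambda=\frac12L(L-1)$ with $L=2l+k$.) Then: 1. $\ker(\Omega''-2\lambda)_K\neq\{0\}$ if and only if $\lambda$ is admissible. 2. If $\lambda$ is admissible, then $\ker(\Omega''-2\lambda)_K$ is the complex linear span of the functions $$F_{m,l,k}(\theta,y)=e^{-im\theta/2}\,e^{-is\rho^2}\,\rho^{2l}\,h_k(y)\;{}_1F_1\!\left(\tfrac{m+4l+2k+n}{4},\,2l+k+\tfrac n2,\,2is\rho^2\right),$$ where $(l,k)$ runs over the $\lambda$-admissible pairs, $h_k$ over $\mathcal H_k(\mathbb R^n)$, and $m$ over the integers with $m\equiv 2k+q \pmod 4$. -/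

import Mathlib

open scoped ContDiff

noncomputable section

namespace SingularSchrodinger

/-- Complex valued functions `F(θ, y)` on `ℝ × ℝⁿ`, where `ℝⁿ` carries the Euclidean norm. -/
abbrev Fn (n : ℕ) : Type := ℝ × EuclideanSpace ℝ (Fin n) → ℂ

/-- The compact picture `I''(q, -n/2, s)`: smooth functions on `ℝ × ℝⁿ` such that
`F(θ + jπ, (-1)^j y) = i^{-jq} F(θ, y)` for all integers `j`.
As a space of functions it does not depend on `s`. -/
def compactPicture (n : ℕ) (q : ZMod 4) : Submodule ℂ (Fn n) where
  carrier := {F | ContDiff ℝ ∞ F ∧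
    ∀ (j : ℤ) (θ : ℝ) (y : EuclideanSpace ℝ (Fin n)),
      F (θ + j * Real.pi, (-1 : ℝ) ^ j • y) = Complex.I ^ (-(j * (q.val : ℤ))) * F (θ, y)}
  zero_mem' := ⟨contDiff_const, fun j θ y => by simp⟩
  add_mem' := by
    rintro F G ⟨hF, hF'⟩ ⟨hG, hG'⟩
    refine ⟨hF.add hG, fun j θ y => ?_⟩
    simp only [Pi.add_apply, hF', hG', mul_add]
  smul_mem' := by
    rintro c F ⟨hF, hF'⟩
    refine ⟨contDiff_const.smul hF, fun j θ y => ?_⟩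
    simp only [Pi.smul_apply, hF', smul_eq_mul]
    ring

/-- The differential operator `Ω'' = ‖y‖² (4s ∂_θ + 4s² ‖y‖² + Δ_n)`. -/
def OmegaOp (n : ℕ) (s : ℂ) (F : Fn n) : Fn n := fun p =>
  ((‖p.2‖ ^ 2 : ℝ) : ℂ) *
    (4 * s * deriv (fun t : ℝ => F (t, p.2)) p.1 +
      4 * s ^ 2 * ((‖p.2‖ ^ 2 : ℝ) : ℂ) * F p +
      Laplacian.laplacian (fun y : EuclideanSpace ℝ (Fin n) => F (p.1, y)) p.2)

theorem contDiff_slice_fst {n : ℕ} {F : Fn n} (hF : ContDiff ℝ ∞ F)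
    (y : EuclideanSpace ℝ (Fin n)) : ContDiff ℝ ∞ (fun t : ℝ => F (t, y)) :=
  hF.comp (contDiff_id.prodMk contDiff_const)

theorem contDiff_slice_snd {n : ℕ} {F : Fn n} (hF : ContDiff ℝ ∞ F) (θ : ℝ) :
    ContDiff ℝ 2 (fun y : EuclideanSpace ℝ (Fin n) => F (θ, y)) :=
  (contDiff_infty.1 hF 2).comp (contDiff_const.prodMk contDiff_id)

theorem OmegaOp_add {n : ℕ} (s : ℂ) {F G : Fn n} (hF : ContDiff ℝ ∞ F) (hG : ContDiff ℝ ∞ G) :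
    OmegaOp n s (F + G) = OmegaOp n s F + OmegaOp n s G := by
  funext p
  have h1 : deriv (fun t : ℝ => F (t, p.2) + G (t, p.2)) p.1
      = deriv (fun t : ℝ => F (t, p.2)) p.1 + deriv (fun t : ℝ => G (t, p.2)) p.1 :=
    deriv_fun_add ((contDiff_slice_fst hF p.2).differentiable (by simp) _)
      ((contDiff_slice_fst hG p.2).differentiable (by simp) _)
  have h2 := ContDiffAt.laplacian_add (contDiff_slice_snd hF p.1).contDiffAt
    (contDiff_slice_snd hG p.1).contDiffAt (x := p.2)
  have h3 : (fun y : EuclideanSpace ℝ (Fin n) => F (p.1, y) + G (p.1, y))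
      = (fun y => F (p.1, y)) + (fun y => G (p.1, y)) := rfl
  simp only [OmegaOp, Pi.add_apply, h1, h3, h2]
  ring

theorem OmegaOp_smul {n : ℕ} (s c : ℂ) {F : Fn n} (hF : ContDiff ℝ ∞ F) :
    OmegaOp n s (c • F) = c • OmegaOp n s F := by
  funext p
  have h1 : deriv (fun t : ℝ => c * F (t, p.2)) p.1
      = c * deriv (fun t : ℝ => F (t, p.2)) p.1 :=
    deriv_const_mul c ((contDiff_slice_fst hF p.2).differentiable (by simp) _)
  have h2 := InnerProductSpace.laplacian_smul c
    (contDiff_slice_snd hF p.1).contDiffAt (x := p.2)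
  have h3 : (fun y : EuclideanSpace ℝ (Fin n) => c * F (p.1, y))
      = c • (fun y => F (p.1, y)) := rfl
  simp only [OmegaOp, Pi.smul_apply, smul_eq_mul, h1, h3, h2]
  ring

/-- `ker (Ω'' - 2λ) ⊂ I''(q, -n/2, s)`. -/
def kerOmega (n : ℕ) (q : ZMod 4) (s lam : ℂ) : Submodule ℂ (Fn n) where
  carrier := {F | F ∈ compactPicture n q ∧ OmegaOp n s F = (2 * lam) • F}
  zero_mem' := by
    refine ⟨Submodule.zero_mem _, ?_⟩
    have h := OmegaOp_smul (n := n) s 0 (F := 0) contDiff_const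
    simpa using h
  add_mem' := by
    rintro F G ⟨hF, hF'⟩ ⟨hG, hG'⟩
    exact ⟨Submodule.add_mem _ hF hG, by rw [OmegaOp_add s hF.1 hG.1, hF', hG', smul_add]⟩
  smul_mem' := by
    rintro c F ⟨hF, hF'⟩
    exact ⟨Submodule.smul_mem _ c hF, by rw [OmegaOp_smul s c hF.1, hF', smul_comm]⟩

/-- The action of `K = K₂ × O(n)`: the rotation of angle `α` in the double cover `K₂` (a circle of
length `4π`) together with `u ∈ O(n)` sends `F` to `(θ, y) ↦ F(θ - α, u⁻¹ y)`. -/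
def kAct (n : ℕ) (α : ℝ) (u : EuclideanSpace ℝ (Fin n) ≃ₗᵢ[ℝ] EuclideanSpace ℝ (Fin n)) :
    Fn n →ₗ[ℂ] Fn n :=
  LinearMap.funLeft ℂ ℂ (fun p : ℝ × EuclideanSpace ℝ (Fin n) => (p.1 - α, u.symm p.2))

/-- The linear span of the `K`-orbit of `F`. -/
def kSpan (n : ℕ) (F : Fn n) : Submodule ℂ (Fn n) :=
  Submodule.span ℂ (Set.range
    (fun g : ℝ × (EuclideanSpace ℝ (Fin n) ≃ₗᵢ[ℝ] EuclideanSpace ℝ (Fin n)) => kAct n g.1 g.2 F))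

/-- `F` is `K`-finite: its `K`-translates span a finite dimensional space. -/
def IsKFinite (n : ℕ) (F : Fn n) : Prop := FiniteDimensional ℂ (kSpan n F)

/-- The space `ker (Ω'' - 2λ)_K` of `K`-finite vectors in `ker (Ω'' - 2λ) ⊂ I''(q, -n/2, s)`. -/
def kerOmegaK (n : ℕ) (q : ZMod 4) (s lam : ℂ) : Submodule ℂ (Fn n) where
  carrier := {F | F ∈ kerOmega n q s lam ∧ IsKFinite n F}
  zero_mem' := by
    refine ⟨Submodule.zero_mem _, ?_⟩
    have h : kSpan n (0 : Fn n) = ⊥ := by simp [kSpan]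
    unfold IsKFinite
    rw [h]
    infer_instance
  add_mem' := by
    rintro F G ⟨hF, hF'⟩ ⟨hG, hG'⟩
    refine ⟨Submodule.add_mem _ hF hG, ?_⟩
    unfold IsKFinite at *
    have h : kSpan n (F + G) ≤ kSpan n F ⊔ kSpan n G := by
      refine Submodule.span_le.2 ?_
      rintro _ ⟨g, rfl⟩
      simp only [map_add]
      exact Submodule.add_mem_sup (Submodule.subset_span ⟨g, rfl⟩) (Submodule.subset_span ⟨g, rfl⟩)
    exact Submodule.finiteDimensional_of_le h
  smul_mem' := by
    rintro c F ⟨hF, hF'⟩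
    refine ⟨Submodule.smul_mem _ c hF, ?_⟩
    unfold IsKFinite at *
    have h : kSpan n (c • F) ≤ kSpan n F := by
      refine Submodule.span_le.2 ?_
      rintro _ ⟨g, rfl⟩
      simp only [map_smul]
      exact Submodule.smul_mem _ c (Submodule.subset_span ⟨g, rfl⟩)
    exact Submodule.finiteDimensional_of_le h

/-- `𝓗_k(ℝⁿ)`: complex homogeneous polynomials of degree `k` in `n` variables that are
annihilated by the Laplacian. -/
def harmonicPoly (n k : ℕ) : Set (MvPolynomial (Fin n) ℂ) :=
  {h | h.IsHomogeneous k ∧ ∑ i, MvPolynomial.pderiv i (MvPolynomial.pderiv i h) = 0}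

/-- Kummer's confluent hypergeometric function of the first kind
`₁F₁(a, b, z) = ∑_j (a)_j / ((b)_j j!) z^j`, for `b` not a nonpositive integer. -/
def kummer (a b z : ℂ) : ℂ :=
  ∑' j : ℕ, (ascPochhammer ℂ j).eval a / ((ascPochhammer ℂ j).eval b * (j.factorial : ℂ)) * z ^ j

/-- The functions `F_{m,l,k}(θ, y) = e^{-imθ/2} e^{-isρ²} ρ^{2l} h(y)
₁F₁((m + 4l + 2k + n)/4, 2l + k + n/2, 2isρ²)`, where `ρ = ‖y‖` and `h` is a polynomial. -/
def Fmlk (n : ℕ) (s : ℂ) (m : ℤ) (l k : ℕ) (h : MvPolynomial (Fin n) ℂ) : Fn n := fun p =>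
  Complex.exp (-(Complex.I * m * p.1) / 2) *
    Complex.exp (-(Complex.I * s * (‖p.2‖ : ℂ) ^ 2)) *
    (‖p.2‖ : ℂ) ^ (2 * l) *
    MvPolynomial.eval (fun i => ((p.2 i : ℝ) : ℂ)) h *
    kummer (((m : ℂ) + 4 * l + 2 * k + n) / 4) (2 * l + k + (n : ℂ) / 2)
      (2 * Complex.I * s * (‖p.2‖ : ℂ) ^ 2)

/-- The set `A_n`: the triangular numbers `l(l-1)/2` if `n = 1`, and
`{l(n + 2j) : l, j ∈ ℤ, 1 ≤ l ≤ j + 1}` if `n ≥ 2`. -/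
def admissibleSet (n : ℕ) : Set ℂ :=
  if n = 1 then {lam | ∃ l : ℕ, lam = (l : ℂ) * ((l : ℂ) - 1) / 2}
  else {lam | ∃ l j : ℤ, 1 ≤ l ∧ l ≤ j + 1 ∧ lam = (l : ℂ) * ((n : ℂ) + 2 * (j : ℂ))}

/-- The pair `(l, k)` is `λ`-admissible: `λ = l(2l + 2k + n - 2)`, where `l ≥ 1` if `n ≥ 2`, while
for `n = 1` one has `l ≥ 0` and `k ∈ {0, 1}`. In the case `n = 1` this says
`λ = L(L-1)/2` with `L = 2l + k`, the order of vanishing of `ρ^{2l} y^k` at `0`. -/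
def IsAdmissiblePair (n : ℕ) (lam : ℂ) (l k : ℕ) : Prop :=
  lam = (l : ℂ) * (2 * (l : ℂ) + 2 * (k : ℂ) + (n : ℂ) - 2) ∧
    (2 ≤ n → 1 ≤ l) ∧ (n = 1 → k ≤ 1)

end SingularSchrodinger

end

/-!
On a Fourier mode `e^{-imθ/2} f(y)` the equation `Ω'' F = 2λF` becomes `‖y‖² (V + Δ) f = 2λ f`
with a smooth potential `V`. The term `‖y‖² V f` vanishes to higher order at `0` than `f` does, so
the leading Taylor polynomial of `f` is an eigenvector of `‖y‖² Δ` with eigenvalue `2λ`, hence a sum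
of terms `ρ^{2l} h_k` with `(l, k)` `λ`-admissible; the symmetry of `F` forces `m ≡ 2k + q (mod 4)`.
`F_{m,l,k}` is the solution with that same leading term, the Kummer equation being the radial part
of the PDE. Subtracting it raises the order of vanishing, and as the degrees `2l + k` of admissible
pairs are bounded, after finitely many subtractions the remainder is flat at `0`.

A flat `K`-finite solution is zero: it lies in a finite-dimensional rotation-invariant space, and
along each ray this turns the PDE into a linear system of ODEs with a regular singular point at the
origin, whose solutions are bounded below by a power of the distance to the origin unless they
vanish.
-/

noncomputable section

namespace SingularSchrodinger

section HarmonicPolynomials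

open MvPolynomial

/-- The polynomial `‖y‖² = ∑ yᵢ²`. -/
def normSqPoly (σ R : Type*) [Fintype σ] [CommSemiring R] : MvPolynomial σ R := ∑ i, X i ^ 2

/-- The Laplacian `∑ ∂ᵢ²` on polynomials. -/
def lapPoly (σ R : Type*) [Fintype σ] [CommSemiring R] :
    MvPolynomial σ R →ₗ[R] MvPolynomial σ R :=
  ∑ i, (pderiv i).toLinearMap ∘ₗ (pderiv i).toLinearMap

section CommSemiring

variable {σ R : Type*} [Fintype σ] [CommSemiring R] {d : ℕ} {P : MvPolynomial σ R}

theorem lapPoly_apply (P : MvPolynomial σ R) : lapPoly σ R P = ∑ i, pderiv i (pderiv i P) := by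
  simp [lapPoly]

theorem isHomogeneous_normSqPoly : (normSqPoly σ R).IsHomogeneous 2 :=
  IsHomogeneous.sum _ _ _ fun i _ => isHomogeneous_X_pow i 2

theorem isHomogeneous_lapPoly (hP : P.IsHomogeneous d) :
    (lapPoly σ R P).IsHomogeneous (d - 2) := by
  rw [lapPoly_apply]
  exact IsHomogeneous.sum _ _ _ fun _ _ => hP.pderiv.pderiv

theorem lapPoly_eq_zero_of_lt_two (hP : P.IsHomogeneous d) (hd : d < 2) : lapPoly σ R P = 0 := by
  rw [lapPoly_apply]
  refine Finset.sum_eq_zero fun i _ => ?_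
  have pderiv_hom : (pderiv i P).IsHomogeneous 0 := by
    simpa [show d - 1 = 0 by omega] using hP.pderiv (i := i)
  rw [totalDegree_eq_zero_iff_eq_C.1 (Nat.le_zero.1 pderiv_hom.totalDegree_le), pderiv_C]

theorem isHomogeneous_normSqPoly_mul_lapPoly (hP : P.IsHomogeneous d) :
    (normSqPoly σ R * lapPoly σ R P).IsHomogeneous d := by
  rcases lt_or_ge d 2 with hd | hd
  · rw [lapPoly_eq_zero_of_lt_two hP hd, mul_zero]
    exact isHomogeneous_zero σ R d
  · simpa [hd] using isHomogeneous_normSqPoly.mul (isHomogeneous_lapPoly hP)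

theorem normSqPoly_ne_zero [Nonempty σ] [Nontrivial R] : normSqPoly σ R ≠ 0 := by
  classical
  intro h
  have := congrArg (eval (Pi.single (Classical.arbitrary σ) (1 : R))) h
  simp [normSqPoly, Pi.single_apply] at this

theorem pderiv_normSqPoly (i : σ) : pderiv i (normSqPoly σ R) = 2 * X i := by
  classical
  simp [normSqPoly, pderiv_X, Derivation.leibniz_pow, Pi.single_apply]

theorem lapPoly_normSqPoly_mul {Q : MvPolynomial σ R} (hQ : Q.IsHomogeneous d) :
    lapPoly σ R (normSqPoly σ R * Q) =
      (2 * (Fintype.card σ : R) + 4 * d) • Q + normSqPoly σ R * lapPoly σ R Q := by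
  have pderiv_two (i : σ) : pderiv i (2 : MvPolynomial σ R) = 0 := by
    rw [← map_ofNat (C : R →+* MvPolynomial σ R) 2, pderiv_C]
  have pderiv_pderiv (i : σ) : pderiv i (pderiv i (normSqPoly σ R * Q)) =
      2 * Q + 4 * (X i * pderiv i Q) + normSqPoly σ R * pderiv i (pderiv i Q) := by
    simp only [Derivation.leibniz, map_add, pderiv_normSqPoly, smul_eq_mul, pderiv_two,
      pderiv_X_self]
    ring
  simp only [lapPoly_apply, pderiv_pderiv, Finset.sum_add_distrib, ← Finset.mul_sum,
    hQ.sum_X_mul_pderiv, Finset.sum_const, Finset.card_univ, nsmul_eq_mul, smul_eq_C_mul,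
    map_add, map_mul, map_ofNat, map_natCast]
  ring

end CommSemiring

/-- If `P` is an eigenvector with nonzero eigenvalue, then `P = ‖y‖² Q` and `Q` is again an
eigenvector, of degree lower by two. -/
theorem exists_eq_normSqPoly_pow_mul {σ K : Type*} [Fintype σ] [Nonempty σ] [Field K] {d : ℕ}
    {ν : K} {P : MvPolynomial σ K} (hP : P.IsHomogeneous d) (hP₀ : P ≠ 0)
    (hν : normSqPoly σ K * lapPoly σ K P = ν • P) :
    ∃ (l k : ℕ) (h : MvPolynomial σ K), d = 2 * l + k ∧ h.IsHomogeneous k ∧ lapPoly σ K h = 0 ∧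
      P = normSqPoly σ K ^ l * h ∧
      ν = 2 * ((l : K) * (2 * (l : K) + 2 * (k : K) + (Fintype.card σ : K) - 2)) := by
  induction d using Nat.strong_induction_on generalizing ν P with
  | _ d ih =>
    by_cases hν₀ : ν = 0
    · refine ⟨0, d, P, by simp, hP, ?_, by simp, by simp [hν₀]⟩
      simpa [hν₀, normSqPoly_ne_zero] using hν
    set Q := ν⁻¹ • lapPoly σ K P with hQ
    have lap_eq : lapPoly σ K P = ν • Q := by rw [hQ, smul_inv_smul₀ hν₀]
    have P_eq : P = normSqPoly σ K * Q := by rw [hQ, mul_smul_comm, hν, inv_smul_smul₀ hν₀]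
    have Q_ne : Q ≠ 0 := right_ne_zero_of_mul (P_eq ▸ hP₀)
    have Q_hom : Q.IsHomogeneous (d - 2) :=
      (homogeneousSubmodule σ K _).smul_mem _ (isHomogeneous_lapPoly hP)
    have d_eq : d = 2 + (d - 2) :=
      hP.inj_right (by simpa only [← P_eq] using isHomogeneous_normSqPoly.mul Q_hom) hP₀
    have Q_eigen : normSqPoly σ K * lapPoly σ K Q =
        (ν - (2 * (Fintype.card σ : K) + 4 * ((d - 2 : ℕ) : K))) • Q := by
      rw [sub_smul, ← lap_eq, P_eq, lapPoly_normSqPoly_mul Q_hom, add_sub_cancel_left]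
    obtain ⟨l, k, h, hlk, h_hom, h_harm, Q_eq, ν_eq⟩ := ih (d - 2) (by omega) Q_hom Q_ne Q_eigen
    refine ⟨l + 1, k, h, by omega, h_hom, h_harm, by rw [P_eq, Q_eq]; ring, ?_⟩
    rw [hlk] at ν_eq
    push_cast at ν_eq ⊢
    linear_combination ν_eq

end HarmonicPolynomials

section VanishingOrder

open scoped Topology Nat

variable {E F : Type*} [NormedAddCommGroup E] [NormedSpace ℝ E] [NormedAddCommGroup F]
  [NormedSpace ℝ F]

/-- All derivatives of `f` of order less than `N` vanish at the origin. -/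
def VanishesToOrder (N : ℕ) (f : E → F) : Prop :=
  ∀ k < N, iteratedFDeriv ℝ k f 0 = 0

namespace VanishesToOrder

variable {f g : E → F} {M N : ℕ}

theorem zero (f : E → F) : VanishesToOrder 0 f := fun _ hk => absurd hk (Nat.not_lt_zero _)

theorem mono (hMN : M ≤ N) (hf : VanishesToOrder N f) : VanishesToOrder M f :=
  fun k hk => hf k (hk.trans_le hMN)

theorem add (hf : ContDiff ℝ ∞ f) (hg : ContDiff ℝ ∞ g) (hfN : VanishesToOrder N f)
    (hgN : VanishesToOrder N g) : VanishesToOrder N (f + g) := fun k hk => by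
  rw [iteratedFDeriv_add_apply (contDiff_infty.1 hf k).contDiffAt
    (contDiff_infty.1 hg k).contDiffAt, hfN k hk, hgN k hk, add_zero]

theorem sub (hf : ContDiff ℝ ∞ f) (hg : ContDiff ℝ ∞ g) (hfN : VanishesToOrder N f)
    (hgN : VanishesToOrder N g) : VanishesToOrder N (f - g) := fun k hk => by
  rw [iteratedFDeriv_sub_apply (contDiff_infty.1 hf k).contDiffAt
    (contDiff_infty.1 hg k).contDiffAt, hfN k hk, hgN k hk, sub_zero]

theorem const_smul [NormedSpace ℂ F] (c : ℂ) (hf : ContDiff ℝ ∞ f) (hfN : VanishesToOrder N f) :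
    VanishesToOrder N (c • f) := fun k hk => by
  rw [iteratedFDeriv_const_smul_apply (contDiff_infty.1 hf k).contDiffAt, hfN k hk, smul_zero]

theorem sum {ι : Type*} {s : Finset ι} {f : ι → E → F} (hf : ∀ i ∈ s, ContDiff ℝ ∞ (f i))
    (hfN : ∀ i ∈ s, VanishesToOrder N (f i)) : VanishesToOrder N (∑ i ∈ s, f i) := fun k hk => by
  rw [iteratedFDeriv_sum_apply fun i hi => (contDiff_infty.1 (hf i hi) k).contDiffAt,
    Finset.sum_eq_zero fun i hi => hfN i hi k hk]

theorem mul {f g : E → ℂ} (hf : ContDiff ℝ ∞ f) (hg : ContDiff ℝ ∞ g) (hfM : VanishesToOrder M f)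
    (hgN : VanishesToOrder N g) : VanishesToOrder (M + N) (f * g) := fun k hk => by
  refine norm_le_zero_iff.1 ((norm_iteratedFDeriv_mul_le hf hg 0 (n := k)
    (mod_cast le_top)).trans_eq ?_)
  refine Finset.sum_eq_zero fun i hi => ?_
  rcases lt_or_ge i M with hiM | hiM
  · simp [hfM i hiM]
  · simp [hgN (k - i) (by grind)]

theorem clm_comp {G : Type*} [NormedAddCommGroup G] [NormedSpace ℝ G] (L : F →L[ℝ] G)
    (hf : ContDiff ℝ ∞ f) (hfN : VanishesToOrder N f) :
    VanishesToOrder N (fun y => L (f y)) := fun k hk => by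
  change iteratedFDeriv ℝ k (L ∘ f) 0 = 0
  rw [L.iteratedFDeriv_comp_left (contDiff_infty.1 hf k).contDiffAt le_rfl, hfN k hk]
  ext
  simp

theorem comp_isometry (u : E ≃ₗᵢ[ℝ] E) (hfN : VanishesToOrder N f) :
    VanishesToOrder N (f ∘ u) := fun k hk => by
  rw [← norm_eq_zero, u.norm_iteratedFDeriv_comp_right, map_zero, hfN k hk, norm_zero]

theorem comp_neg (hfN : VanishesToOrder N f) : VanishesToOrder N fun y => f (-y) :=
  hfN.comp_isometry (.neg ℝ)

end VanishesToOrder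

variable {f : E → F} {N : ℕ}

theorem vanishesToOrder_succ_iff :
    VanishesToOrder (N + 1) f ↔ f 0 = 0 ∧ VanishesToOrder N (fderiv ℝ f) := by
  have iteratedFDeriv_succ (k : ℕ) :
      iteratedFDeriv ℝ (k + 1) f 0 = 0 ↔ iteratedFDeriv ℝ k (fderiv ℝ f) 0 = 0 := by
    rw [← norm_eq_zero, ← norm_iteratedFDeriv_fderiv, norm_eq_zero]
  have iteratedFDeriv_zero : iteratedFDeriv ℝ 0 f 0 = 0 ↔ f 0 = 0 := by
    rw [← norm_eq_zero, norm_iteratedFDeriv_zero, norm_eq_zero]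
  simp only [VanishesToOrder, ← iteratedFDeriv_succ, ← iteratedFDeriv_zero]
  exact Nat.forall_lt_succ_left

theorem exists_bound_iteratedFDeriv (hf : ContDiff ℝ ∞ f) (k : ℕ) :
    ∃ δ > 0, ∃ C, ∀ y ∈ Metric.ball (0 : E) δ, ‖iteratedFDeriv ℝ k f y‖ ≤ C := by
  have cont : Continuous fun y => ‖iteratedFDeriv ℝ k f y‖ :=
    (hf.continuous_iteratedFDeriv (mod_cast le_top)).norm
  obtain ⟨δ, hδ, bound⟩ := Metric.eventually_nhds_iff_ball.1
    (cont.continuousAt.eventually_le_const (lt_add_one ‖iteratedFDeriv ℝ k f 0‖))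
  exact ⟨δ, hδ, _, bound⟩

theorem VanishesToOrder.isBigO [CompleteSpace F] (hf : ContDiff ℝ ∞ f)
    (hfN : VanishesToOrder N f) : f =O[𝓝 0] fun y => ‖y‖ ^ N := by
  rcases N with _ | N
  · simpa using hf.continuous.continuousAt.isBigO_one ℝ
  obtain ⟨δ, hδ, C, bound⟩ := exists_bound_iteratedFDeriv hf (N + 1)
  refine .of_bound ((N ! : ℝ)⁻¹ * C) ?_
  filter_upwards [Metric.ball_mem_nhds 0 hδ] with y hy
  have taylor : f y = (N ! : ℝ)⁻¹ •
      ∫ t in 0..1, (1 - t) ^ N • iteratedFDeriv ℝ (N + 1) f (t • y) fun _ => y := by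
    have := map_add_eq_sum_add_integral_iteratedFDeriv (f := f) (x := 0) (y := y) (n := N)
      fun t _ => (contDiff_infty.1 hf (N + 1)).contDiffAt
    rw [Finset.sum_eq_zero fun k hk => by simp [hfN k (Finset.mem_range.1 hk)]] at this
    simpa only [zero_add] using this
  have integrand_le (t : ℝ) (ht : t ∈ Set.uIoc 0 1) :
      ‖(1 - t) ^ N • iteratedFDeriv ℝ (N + 1) f (t • y) fun _ => y‖ ≤ C * ‖y‖ ^ (N + 1) := by
    rw [Set.uIoc_of_le zero_le_one] at ht
    have ty_mem : t • y ∈ Metric.ball (0 : E) δ := by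
      rw [mem_ball_zero_iff, norm_smul, Real.norm_of_nonneg ht.1.le]
      exact (mul_le_of_le_one_left (norm_nonneg y) ht.2).trans_lt (mem_ball_zero_iff.1 hy)
    have weight_le : ‖(1 - t) ^ N‖ ≤ 1 := by
      rw [norm_pow, Real.norm_of_nonneg (by linarith [ht.2])]
      exact pow_le_one₀ (by linarith [ht.2]) (by linarith [ht.1])
    calc _ ≤ 1 * (‖iteratedFDeriv ℝ (N + 1) f (t • y)‖ * ‖y‖ ^ (N + 1)) := by
          rw [norm_smul]
          gcongr
          simpa using (iteratedFDeriv ℝ (N + 1) f (t • y)).le_opNorm fun _ => y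
      _ ≤ C * ‖y‖ ^ (N + 1) := by
          rw [one_mul]
          gcongr
          exact bound _ ty_mem
  rw [taylor, norm_smul, norm_inv, Real.norm_natCast, norm_pow, norm_norm, mul_assoc]
  gcongr
  simpa using intervalIntegral.norm_integral_le_of_norm_le_const integrand_le

end VanishingOrder

section PolynomialFunctions

open MvPolynomial

variable {n : ℕ} {f g : EuclideanSpace ℝ (Fin n) → ℂ}

/-- The partial derivative `∂ᵢ f`. -/
def partialDeriv (i : Fin n) (f : EuclideanSpace ℝ (Fin n) → ℂ) : EuclideanSpace ℝ (Fin n) → ℂ :=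
  fun y => fderiv ℝ f y (EuclideanSpace.single i 1)

theorem contDiff_partialDeriv (hf : ContDiff ℝ ∞ f) (i : Fin n) :
    ContDiff ℝ ∞ (partialDeriv i f) :=
  (hf.fderiv_right (m := ∞) (by simp)).clm_apply contDiff_const

theorem partialDeriv_add (hf : Differentiable ℝ f) (hg : Differentiable ℝ g) (i : Fin n) :
    partialDeriv i (f + g) = partialDeriv i f + partialDeriv i g := by
  funext y
  simp [partialDeriv, fderiv_add (hf y) (hg y)]

theorem partialDeriv_sub (hf : Differentiable ℝ f) (hg : Differentiable ℝ g) (i : Fin n) :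
    partialDeriv i (f - g) = partialDeriv i f - partialDeriv i g := by
  funext y
  simp [partialDeriv, fderiv_sub (hf y) (hg y)]

theorem partialDeriv_mul (hf : Differentiable ℝ f) (hg : Differentiable ℝ g) (i : Fin n) :
    partialDeriv i (f * g) = partialDeriv i f * g + f * partialDeriv i g := by
  funext y
  simp only [partialDeriv, fderiv_mul (hf y) (hg y), Pi.add_apply, Pi.mul_apply,
    add_apply, smul_apply, smul_eq_mul]
  ring

theorem partialDeriv_partialDeriv (hf : ContDiff ℝ ∞ f) (i j : Fin n)
    (y : EuclideanSpace ℝ (Fin n)) :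
    partialDeriv i (partialDeriv j f) y =
      fderiv ℝ (fderiv ℝ f) y (EuclideanSpace.single i 1) (EuclideanSpace.single j 1) := by
  have : DifferentiableAt ℝ (fderiv ℝ f) y :=
    (hf.fderiv_right (m := ∞) (by simp)).differentiable (by simp) y
  change fderiv ℝ (fun y => fderiv ℝ f y (EuclideanSpace.single j 1)) y _ = _
  simp [fderiv_clm_apply this]

theorem partialDeriv_comm (hf : ContDiff ℝ ∞ f) (i j : Fin n) :
    partialDeriv i (partialDeriv j f) = partialDeriv j (partialDeriv i f) := by
  funext y
  rw [partialDeriv_partialDeriv hf, partialDeriv_partialDeriv hf]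
  exact ((contDiff_infty.1 hf 2).contDiffAt.isSymmSndFDerivAt (by simp)) _ _

theorem laplacian_eq_sum_partialDeriv (hf : ContDiff ℝ ∞ f) :
    Laplacian.laplacian f = ∑ i, partialDeriv i (partialDeriv i f) := by
  funext y
  simp [InnerProductSpace.laplacian_eq_iteratedFDeriv_orthonormalBasis f
    (EuclideanSpace.basisFun (Fin n) ℝ), partialDeriv_partialDeriv hf, iteratedFDeriv_two_apply]

theorem contDiff_laplacian (hf : ContDiff ℝ ∞ f) : ContDiff ℝ ∞ (Laplacian.laplacian f) := by
  rw [laplacian_eq_sum_partialDeriv hf, Finset.sum_fn]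
  exact ContDiff.sum fun i _ => contDiff_partialDeriv (contDiff_partialDeriv hf i) i

theorem fderiv_apply_eq_sum_partialDeriv (f : EuclideanSpace ℝ (Fin n) → ℂ)
    (y v : EuclideanSpace ℝ (Fin n)) : fderiv ℝ f y v = ∑ i, (v i : ℂ) * partialDeriv i f y := by
  conv_lhs => rw [← (EuclideanSpace.basisFun (Fin n) ℝ).sum_repr v]
  simp [partialDeriv]

theorem vanishesToOrder_succ_iff_partialDeriv (hf : ContDiff ℝ ∞ f) {N : ℕ} :
    VanishesToOrder (N + 1) f ↔ f 0 = 0 ∧ ∀ i, VanishesToOrder N (partialDeriv i f) := by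
  rw [vanishesToOrder_succ_iff]
  refine and_congr_right fun _ => ⟨fun h i => ?_, fun h => ?_⟩
  · exact h.clm_comp (ContinuousLinearMap.apply ℝ ℂ (EuclideanSpace.single i 1))
      (hf.fderiv_right (by simp))
  · let coordSmul (i : Fin n) : ℂ →L[ℝ] EuclideanSpace ℝ (Fin n) →L[ℝ] ℂ :=
      ContinuousLinearMap.smulRightL ℝ _ ℂ (EuclideanSpace.proj i)
    have fderiv_eq : fderiv ℝ f = ∑ i, fun y => coordSmul i (partialDeriv i f y) := by
      ext y v
      simp [coordSmul, fderiv_apply_eq_sum_partialDeriv]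
    rw [fderiv_eq]
    exact .sum (fun i _ => (coordSmul i).contDiff.comp (contDiff_partialDeriv hf i))
      fun i _ => (h i).clm_comp _ (contDiff_partialDeriv hf i)

theorem VanishesToOrder.laplacian (hf : ContDiff ℝ ∞ f) {N : ℕ} (hfN : VanishesToOrder (N + 2) f) :
    VanishesToOrder N (Laplacian.laplacian f) := by
  rw [laplacian_eq_sum_partialDeriv hf]
  have partialDeriv_smooth := contDiff_partialDeriv hf
  refine .sum (fun i _ => contDiff_partialDeriv (partialDeriv_smooth i) i) fun i _ => ?_
  have := ((vanishesToOrder_succ_iff_partialDeriv hf).1 hfN).2 i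
  exact ((vanishesToOrder_succ_iff_partialDeriv (partialDeriv_smooth i)).1 this).2 i

/-- The restriction of complex polynomials to functions on `ℝⁿ`. -/
def polyFun : MvPolynomial (Fin n) ℂ →ₐ[ℂ] (EuclideanSpace ℝ (Fin n) → ℂ) :=
  aeval fun i y => (y i : ℂ)

theorem polyFun_apply (P : MvPolynomial (Fin n) ℂ) (y : EuclideanSpace ℝ (Fin n)) :
    polyFun P y = eval (fun i => (y i : ℂ)) P := by
  have : (Pi.evalAlgHom ℂ (fun _ => ℂ) y).comp polyFun = aeval fun i => (y i : ℂ) := by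
    ext
    simp [polyFun]
  simpa [aeval_eq_eval] using DFunLike.congr_fun this P

theorem polyFun_C (c : ℂ) : polyFun (C c : MvPolynomial (Fin n) ℂ) = fun _ => c :=
  polyFun.commutes c

theorem polyFun_X (i : Fin n) : polyFun (X i) = fun y => (y i : ℂ) :=
  aeval_X _ i

theorem polyFun_normSqPoly :
    polyFun (normSqPoly (Fin n) ℂ) = fun y => ((‖y‖ ^ 2 : ℝ) : ℂ) := by
  funext y
  simp [polyFun_apply, normSqPoly, EuclideanSpace.norm_sq_eq]

theorem contDiff_polyFun (P : MvPolynomial (Fin n) ℂ) : ContDiff ℝ ∞ (polyFun P) := by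
  induction P using MvPolynomial.induction_on with
  | C a => simpa only [polyFun_C] using contDiff_const
  | add p q hp hq =>
    rw [map_add]
    exact hp.add hq
  | mul_X p i hp =>
    rw [map_mul, polyFun_X]
    exact hp.mul (Complex.ofRealCLM.comp (EuclideanSpace.proj i)).contDiff

theorem partialDeriv_coord (i j : Fin n) :
    partialDeriv i (fun y => (y j : ℂ)) = fun _ => (Pi.single i 1 : Fin n → ℂ) j := by
  funext y
  have := (Complex.ofRealCLM.comp
    (EuclideanSpace.proj j : EuclideanSpace ℝ (Fin n) →L[ℝ] ℝ)).hasFDerivAt (x := y)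
  rw [partialDeriv, show fderiv ℝ (fun y => (y j : ℂ)) y = _ from this.fderiv]
  simp [Pi.single_apply, eq_comm, apply_ite]

theorem partialDeriv_polyFun (i : Fin n) (P : MvPolynomial (Fin n) ℂ) :
    partialDeriv i (polyFun P) = polyFun (pderiv i P) := by
  have differentiable (Q : MvPolynomial (Fin n) ℂ) : Differentiable ℝ (polyFun Q) :=
    (contDiff_polyFun Q).differentiable (by simp)
  induction P using MvPolynomial.induction_on with
  | C a =>
    rw [polyFun_C, pderiv_C, map_zero]
    funext y
    simp [partialDeriv]
  | add p q hp hq =>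
    rw [map_add, partialDeriv_add (differentiable p) (differentiable q), hp, hq, map_add, map_add]
  | mul_X p j hp =>
    rw [map_mul, partialDeriv_mul (differentiable p) (differentiable (X j)), hp, polyFun_X,
      partialDeriv_coord]
    rw [pderiv_mul, pderiv_X, map_add, map_mul, map_mul, polyFun_X]
    rcases eq_or_ne j i with rfl | hji
    · simp only [Pi.single_eq_same, map_one]
      rfl
    · simp only [Pi.single_eq_of_ne hji, map_zero]
      rfl

theorem laplacian_polyFun (P : MvPolynomial (Fin n) ℂ) :
    Laplacian.laplacian (polyFun P) = polyFun (lapPoly (Fin n) ℂ P) := by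
  simp only [laplacian_eq_sum_partialDeriv (contDiff_polyFun P), partialDeriv_polyFun,
    lapPoly_apply, map_sum]

variable {N : ℕ} {P : MvPolynomial (Fin n) ℂ}

theorem polyFun_smul_of_isHomogeneous (hP : P.IsHomogeneous N) (t : ℝ)
    (y : EuclideanSpace ℝ (Fin n)) : polyFun P (t • y) = (t : ℂ) ^ N * polyFun P y := by
  simp only [polyFun_apply, eval_eq', PiLp.smul_apply, smul_eq_mul, Complex.ofReal_mul, mul_pow,
    Finset.prod_mul_distrib, Finset.prod_pow_eq_pow_sum, Finset.mul_sum]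
  refine Finset.sum_congr rfl fun d hd => ?_
  rw [hP.degree_eq_sum_deg_support hd, Finset.sum_subset d.support.subset_univ (by simp)]
  ring

theorem polyFun_apply_zero (hP : P.IsHomogeneous (N + 1)) : polyFun P 0 = 0 := by
  simpa using polyFun_smul_of_isHomogeneous hP 0 0

theorem vanishesToOrder_polyFun (hP : P.IsHomogeneous N) : VanishesToOrder N (polyFun P) := by
  induction N generalizing P with
  | zero => exact .zero _
  | succ N ih =>
    refine (vanishesToOrder_succ_iff_partialDeriv (contDiff_polyFun P)).2
      ⟨polyFun_apply_zero hP, fun i => ?_⟩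
    rw [partialDeriv_polyFun]
    exact ih hP.pderiv

theorem eq_zero_of_vanishesToOrder (hP : P.IsHomogeneous N)
    (hPN : VanishesToOrder (N + 1) (polyFun P)) : P = 0 := by
  obtain ⟨polyFun_zero, partialDeriv_vanishes⟩ :=
    (vanishesToOrder_succ_iff_partialDeriv (contDiff_polyFun P)).1 hPN
  induction N generalizing P with
  | zero =>
    rw [totalDegree_eq_zero_iff_eq_C.1 (Nat.le_zero.1 hP.totalDegree_le)] at polyFun_zero ⊢
    rw [polyFun_C] at polyFun_zero
    rw [show coeff 0 P = 0 from polyFun_zero, C_0]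
  | succ N ih =>
    have pderiv_eq_zero (i : Fin n) : pderiv i P = 0 := by
      have := partialDeriv_vanishes i
      rw [partialDeriv_polyFun] at this
      obtain ⟨h₀, h₁⟩ := (vanishesToOrder_succ_iff_partialDeriv (contDiff_polyFun _)).1 this
      exact ih hP.pderiv this h₀ h₁
    have euler := hP.sum_X_mul_pderiv
    simpa [pderiv_eq_zero, Nat.cast_add_one_ne_zero] using euler.symm

theorem pderiv_eq_of_leading_polynomial {Q : MvPolynomial (Fin n) ℂ} {i j : Fin n}
    (hf : ContDiff ℝ ∞ f) (hg : ContDiff ℝ ∞ g) (hfg : partialDeriv j f = partialDeriv i g)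
    (hP : P.IsHomogeneous N) (hQ : Q.IsHomogeneous N)
    (hfP : VanishesToOrder (N + 1) (f - polyFun P))
    (hgQ : VanishesToOrder (N + 1) (g - polyFun Q)) : pderiv j P = pderiv i Q := by
  have vanishes {f : EuclideanSpace ℝ (Fin n) → ℂ} {P} (hf : ContDiff ℝ ∞ f)
      (hfP : VanishesToOrder (N + 1) (f - polyFun P)) (j : Fin n) :
      VanishesToOrder N (partialDeriv j f - polyFun (pderiv j P)) := by
    rw [← partialDeriv_polyFun, ← partialDeriv_sub (hf.differentiable (by simp))
      ((contDiff_polyFun P).differentiable (by simp))]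
    exact ((vanishesToOrder_succ_iff_partialDeriv (hf.sub (contDiff_polyFun P))).1 hfP).2 j
  have difference_vanishes : VanishesToOrder N (polyFun (pderiv j P - pderiv i Q)) := by
    rw [map_sub, ← sub_sub_sub_cancel_left _ _ (partialDeriv i g)]
    exact VanishesToOrder.sub
      ((contDiff_partialDeriv hg i).sub (contDiff_polyFun _))
      (hfg ▸ (contDiff_partialDeriv hf j).sub (contDiff_polyFun _)) (vanishes hg hgQ i)
      (hfg ▸ vanishes hf hfP j)
  obtain rfl | ⟨M, rfl⟩ : N = 0 ∨ ∃ M, N = M + 1 := by cases N <;> simp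
  · rw [totalDegree_eq_zero_iff_eq_C.1 (Nat.le_zero.1 hP.totalDegree_le),
      totalDegree_eq_zero_iff_eq_C.1 (Nat.le_zero.1 hQ.totalDegree_le), pderiv_C, pderiv_C]
  · exact sub_eq_zero.1 (eq_zero_of_vanishesToOrder (hP.pderiv.sub hQ.pderiv) difference_vanishes)

theorem exists_pderiv_eq {Q : Fin n → MvPolynomial (Fin n) ℂ} (hQ : ∀ i, (Q i).IsHomogeneous N)
    (symm : ∀ i j, pderiv j (Q i) = pderiv i (Q j)) :
    ∃ P : MvPolynomial (Fin n) ℂ, P.IsHomogeneous (N + 1) ∧ ∀ j, pderiv j P = Q j := by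
  refine ⟨C (N + 1 : ℂ)⁻¹ * ∑ i, X i * Q i, ?_, fun j => ?_⟩
  · have : (∑ i, X i * Q i).IsHomogeneous (N + 1) :=
      .sum _ _ _ fun i _ => add_comm 1 N ▸ (isHomogeneous_X ℂ i).mul (hQ i)
    simpa using (isHomogeneous_C (Fin n) (N + 1 : ℂ)⁻¹).mul this
  · have pderiv_sum : pderiv j (∑ i, X i * Q i) = C (N + 1 : ℂ) * Q j := by
      have euler : ∑ i, X i * pderiv i (Q j) = N • Q j := (hQ j).sum_X_mul_pderiv
      simp only [map_sum, pderiv_mul, pderiv_X, symm _ j, Finset.sum_add_distrib, euler]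
      simp [Pi.single_apply, add_mul, add_comm]
    rw [pderiv_C_mul, pderiv_sum, ← mul_assoc, ← C_mul, inv_mul_cancel₀ (by norm_cast), C_1,
      one_mul]

theorem exists_leading_polynomial (hf : ContDiff ℝ ∞ f) (hfN : VanishesToOrder N f) :
    ∃ P : MvPolynomial (Fin n) ℂ, P.IsHomogeneous N ∧ VanishesToOrder (N + 1) (f - polyFun P) := by
  induction N generalizing f with
  | zero =>
    refine ⟨C (f 0), isHomogeneous_C _ _, vanishesToOrder_succ_iff.2 ⟨?_, .zero _⟩⟩
    rw [polyFun_C]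
    exact sub_self _
  | succ N ih =>
    obtain ⟨f_zero, partialDeriv_vanishes⟩ := (vanishesToOrder_succ_iff_partialDeriv hf).1 hfN
    have partialDeriv_smooth := contDiff_partialDeriv hf
    choose Q hQ hfQ using fun i => ih (partialDeriv_smooth i) (partialDeriv_vanishes i)
    obtain ⟨P, hP, pderiv_P⟩ := exists_pderiv_eq hQ fun i j =>
      pderiv_eq_of_leading_polynomial (partialDeriv_smooth i) (partialDeriv_smooth j)
        (partialDeriv_comm hf j i) (hQ i) (hQ j) (hfQ i) (hfQ j)
    have polyFun_smooth := contDiff_polyFun P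
    refine ⟨P, hP, (vanishesToOrder_succ_iff_partialDeriv (hf.sub polyFun_smooth)).2
      ⟨by simp [f_zero, polyFun_apply_zero hP], fun i => ?_⟩⟩
    change VanishesToOrder (N + 1) (partialDeriv i (f - polyFun P))
    rw [partialDeriv_sub (hf.differentiable (by simp)) (polyFun_smooth.differentiable (by simp)),
      partialDeriv_polyFun, pderiv_P]
    exact hfQ i

end PolynomialFunctions

section RegularSingularPoint

open Filter Set
open scoped Topology

variable {E : Type*} [NormedAddCommGroup E] [NormedSpace ℝ E]

theorem norm_le_of_norm_smul_deriv_le {p p' : ℝ → E} {R : ℝ} {K : ℕ}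
    (hp : ∀ r, HasDerivAt p (p' r) r) (bound : ∀ r ∈ Ioc 0 R, ‖r • p' r‖ ≤ K * ‖p r‖)
    {ε r : ℝ} (hε : 0 < ε) (hεr : ε ≤ r) (hr : r ≤ R) : ‖p r‖ ≤ ‖p ε‖ * (r / ε) ^ K := by
  have hr₀ : 0 < r := hε.trans_le hεr
  have exp_comp_deriv (τ : ℝ) :
      HasDerivAt (fun τ => p (Real.exp τ)) (Real.exp τ • p' (Real.exp τ)) τ :=
    (hp _).scomp τ (Real.hasDerivAt_exp τ)
  have gronwall := norm_le_gronwallBound_of_norm_deriv_right_le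
    (f := fun τ => p (Real.exp τ)) (δ := ‖p ε‖) (K := K) (ε := 0)
    (a := Real.log ε) (b := Real.log r)
    (fun τ _ => (exp_comp_deriv τ).continuousAt.continuousWithinAt)
    (fun τ _ => (exp_comp_deriv τ).hasDerivWithinAt)
    (by rw [Real.exp_log hε])
    (fun τ hτ => by
      simpa using bound _ ⟨Real.exp_pos τ, ((Real.le_log_iff_exp_le hr₀).1 hτ.2.le).trans hr⟩)
    (Real.log r) (right_mem_Icc.2 (Real.log_le_log hε hεr))
  rwa [gronwallBound_ε0, Real.exp_log hr₀, ← Real.log_div hr₀.ne' hε.ne', Real.exp_nat_mul,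
    Real.exp_log (div_pos hr₀ hε)] at gronwall

theorem eq_zero_of_flat_of_norm_smul_deriv_le {p p' : ℝ → E} {R K : ℝ}
    (hp : ∀ r, HasDerivAt p (p' r) r) (bound : ∀ r ∈ Ioc 0 R, ‖r • p' r‖ ≤ K * ‖p r‖)
    (flat : ∀ N : ℕ, p =O[𝓝[>] 0] fun r => r ^ N) {r : ℝ} (hr : r ∈ Ioc 0 R) : p r = 0 := by
  obtain ⟨M, hKM⟩ := exists_nat_ge K
  obtain ⟨C, hC⟩ := (flat (M + 1)).bound
  have eventually_norm_le : ∀ᶠ ε in 𝓝[>] (0 : ℝ), ‖p r‖ ≤ C * r ^ M * ε := by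
    filter_upwards [hC, Ioc_mem_nhdsGT hr.1] with ε hpε hε
    have hε₀ : 0 < ε := hε.1
    calc ‖p r‖ ≤ ‖p ε‖ * (r / ε) ^ M := norm_le_of_norm_smul_deriv_le hp
          (fun t ht => (bound t ht).trans (by gcongr)) hε₀ hε.2 hr.2
      _ ≤ C * ‖ε ^ (M + 1)‖ * (r / ε) ^ M := by
          have := div_pos hr.1 hε₀
          gcongr
      _ = C * r ^ M * ε := by
          rw [Real.norm_of_nonneg (by positivity), div_pow]
          field_simp
          ring
  have tendsto_zero : Tendsto (fun ε => C * r ^ M * ε) (𝓝[>] 0) (𝓝 (C * r ^ M * 0)) :=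
    (tendsto_id.const_mul _).mono_left nhdsWithin_le_nhds
  rw [mul_zero] at tendsto_zero
  exact norm_le_zero_iff.1 (ge_of_tendsto tendsto_zero eventually_norm_le)

theorem eq_zero_of_flat_of_smul_deriv_eq {p p' : ℝ → E} {B : ℝ → E →L[ℝ] E} (hB : Continuous B)
    (hp : ∀ r, HasDerivAt p (p' r) r) (ode : ∀ r, r • p' r = B r (p r))
    (flat : ∀ N : ℕ, p =O[𝓝[>] 0] fun r => r ^ N) {r : ℝ} (hr : 0 < r) : p r = 0 := by
  obtain ⟨K, hK⟩ := (isCompact_Icc (a := 0) (b := r)).exists_bound_of_continuousOn hB.continuousOn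
  exact eq_zero_of_flat_of_norm_smul_deriv_le hp
    (fun t ht => ode t ▸ (B t).le_of_opNorm_le (hK t (Ioc_subset_Icc_self ht)) (p t)) flat
    (right_mem_Ioc.2 hr)

end RegularSingularPoint

section InvariantSubspaces

open Filter InnerProductSpace Module NormedSpace
open scoped Topology

theorem deriv_mem_of_forall_mem {X : Type*} {W : Submodule ℂ (X → ℂ)} [FiniteDimensional ℂ W]
    {γ : ℝ → X → ℂ} (hγ : ∀ t, γ t ∈ W) {γ' : X → ℂ} {t : ℝ}
    (hγ' : ∀ x, HasDerivAt (fun t => γ t x) (γ' x) t) : γ' ∈ W := by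
  have slope_tendsto : Tendsto (fun u => (u - t)⁻¹ • (γ u - γ t)) (𝓝[≠] t) (𝓝 γ') :=
    tendsto_pi_nhds.2 fun x => by simpa [slope_fun_def] using hasDerivAt_iff_tendsto_slope.1 (hγ' x)
  exact W.closed_of_finiteDimensional.mem_of_tendsto slope_tendsto
    (.of_forall fun u => W.smul_of_tower_mem _ (W.sub_mem (hγ u) (hγ t)))

variable {E : Type*} [NormedAddCommGroup E] [InnerProductSpace ℝ E]
  {W : Submodule ℂ (E → ℂ)} [FiniteDimensional ℂ W] {f : E → ℂ}

theorem fderiv_apply_skewAdjoint_mem [CompleteSpace E] {A : E →L[ℝ] E}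
    (hA : A ∈ skewAdjoint (E →L[ℝ] E)) (hf : ContDiff ℝ ∞ f)
    (invariant : ∀ u : E ≃ₗᵢ[ℝ] E, f ∘ u ∈ W) : (fun y => fderiv ℝ f y (A y)) ∈ W := by
  let _ : NormedAlgebra ℚ (E →L[ℝ] E) := .restrictScalars ℚ ℝ _
  have exp_unitary (t : ℝ) : exp (t • A) ∈ unitary (E →L[ℝ] E) :=
    exp_mem_unitary_of_mem_skewAdjoint (skewAdjoint.smul_mem t hA)
  refine deriv_mem_of_forall_mem (γ := fun t y => f (exp (t • A) y)) (t := 0)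
    (fun t => invariant (Unitary.linearIsometryEquiv ⟨_, exp_unitary t⟩)) fun y => ?_
  have exp_deriv : HasDerivAt (fun t : ℝ => exp (t • A) y) (A y) 0 := by
    simpa using (hasDerivAt_exp_smul_const A (0 : ℝ)).clm_apply (hasDerivAt_const 0 y)
  have f_deriv : HasFDerivAt f (fderiv ℝ f y) (exp ((0 : ℝ) • A) y) := by
    simpa using (hf.differentiable (by simp) y).hasFDerivAt
  exact f_deriv.comp_hasDerivAt 0 exp_deriv

theorem fderiv_fderiv_apply_clm (A : E →L[ℝ] E) (hf : ContDiff ℝ ∞ f) (y v : E) :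
    fderiv ℝ (fun y => fderiv ℝ f y (A y)) y v =
      fderiv ℝ (fderiv ℝ f) y v (A y) + fderiv ℝ f y (A v) := by
  have : DifferentiableAt ℝ (fderiv ℝ f) y :=
    (hf.fderiv_right (m := ∞) (by simp)).differentiable (by simp) y
  simp [fderiv_clm_apply this A.differentiableAt, add_comm]

/-- The infinitesimal rotation in the plane of `e` and `v`, normalized to map `e` to `v`. -/
def planeRotation (e v : E) : E →L[ℝ] E := rankOne ℝ v e - rankOne ℝ e v

theorem planeRotation_mem_skewAdjoint [CompleteSpace E] (e v : E) :
    planeRotation e v ∈ skewAdjoint (E →L[ℝ] E) := by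
  simp [skewAdjoint.mem_iff, planeRotation, ContinuousLinearMap.star_eq_adjoint]

theorem planeRotation_apply_left {e v : E} (he : ‖e‖ = 1) (hev : inner ℝ e v = 0) :
    planeRotation e v e = v := by
  simp [planeRotation, he, real_inner_comm e v, hev]

theorem planeRotation_apply_right {e v : E} (hv : ‖v‖ = 1) (hev : inner ℝ e v = 0) :
    planeRotation e v v = -e := by
  simp [planeRotation, hv, hev]

theorem exists_mem_second_deriv_eq [CompleteSpace E]
    (invariant : ∀ f ∈ W, ∀ u : E ≃ₗᵢ[ℝ] E, f ∘ u ∈ W)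
    (smooth : ∀ f ∈ W, ContDiff ℝ ∞ f) (hf : f ∈ W) {e v : E} (he : ‖e‖ = 1) (hv : ‖v‖ = 1)
    (hev : inner ℝ e v = 0) : ∃ g ∈ W, ∀ r : ℝ, g (r • e) =
      r ^ 2 • fderiv ℝ (fderiv ℝ f) (r • e) v v - r • fderiv ℝ f (r • e) e := by
  let A := planeRotation e v
  have derivation_mem {f : E → ℂ} (hf : f ∈ W) : (fun y => fderiv ℝ f y (A y)) ∈ W :=
    fderiv_apply_skewAdjoint_mem (planeRotation_mem_skewAdjoint e v) (smooth f hf)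
      (invariant f hf)
  refine ⟨_, derivation_mem (derivation_mem hf), fun r => ?_⟩
  have Ae : A e = v := planeRotation_apply_left he hev
  have Av : A v = -e := planeRotation_apply_right hv hev
  simp only [fderiv_fderiv_apply_clm A (smooth f hf), map_smul, map_neg, Ae, Av, smul_apply]
  module

theorem exists_mem_laplacian_eq [FiniteDimensional ℝ E]
    (invariant : ∀ f ∈ W, ∀ u : E ≃ₗᵢ[ℝ] E, f ∘ u ∈ W)
    (smooth : ∀ f ∈ W, ContDiff ℝ ∞ f) (hf : f ∈ W) {e : E} (he : ‖e‖ = 1) :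
    ∃ g ∈ W, ∀ r : ℝ, r ^ 2 • Laplacian.laplacian f (r • e) = g (r • e) +
      (r ^ 2 • fderiv ℝ (fderiv ℝ f) (r • e) e e +
        ((finrank ℝ E : ℝ) - 1) • r • fderiv ℝ f (r • e) e) := by
  classical
  have : CompleteSpace E := FiniteDimensional.complete ℝ E
  have singleton_orthonormal : Orthonormal ℝ ((↑) : ({e} : Set E) → E) := by
    simp [he]
  obtain ⟨s, b, hes, hb⟩ := singleton_orthonormal.exists_orthonormalBasis_extension
  let i₀ : s := ⟨e, hes rfl⟩
  have hbe : b i₀ = e := by simp [hb, i₀]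
  choose g hgW hg using fun i : {i // i ≠ i₀} =>
    exists_mem_second_deriv_eq invariant smooth hf he (b.orthonormal.1 i)
      (hbe ▸ b.orthonormal.2 i.2.symm)
  refine ⟨∑ i, g i, W.sum_mem fun i _ => hgW i, fun r => ?_⟩
  have sum_const : ∑ _i : {i // i ≠ i₀}, r • fderiv ℝ f (r • e) e =
      ((finrank ℝ E : ℝ) - 1) • r • fderiv ℝ f (r • e) e := by
    rw [eq_comm, sub_smul, one_smul, sub_eq_iff_eq_add', finrank_eq_card_basis b.toBasis,
      Nat.cast_smul_eq_nsmul]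
    simpa using Fintype.sum_eq_add_sum_subtype_ne (fun _ => r • fderiv ℝ f (r • e) e) i₀
  simp only [laplacian_eq_iteratedFDeriv_orthonormalBasis f b, iteratedFDeriv_two_apply,
    Finset.sum_apply, hg, Finset.sum_sub_distrib, sum_const, ← Finset.smul_sum,
    Fintype.sum_eq_add_sum_subtype_ne _ i₀, Matrix.cons_val_zero, Matrix.cons_val_one, hbe]
  module

theorem hasDerivAt_comp_smul (hf : ContDiff ℝ ∞ f) (e : E) (r : ℝ) :
    HasDerivAt (fun r : ℝ => f (r • e)) (fderiv ℝ f (r • e) e) r := by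
  have smul_deriv : HasDerivAt (fun r : ℝ => r • e) e r := by
    simpa using (hasDerivAt_id r).smul_const e
  exact (hf.differentiable (by simp) _).hasFDerivAt.comp_hasDerivAt r smul_deriv

theorem hasDerivAt_smul_fderiv_smul (hf : ContDiff ℝ ∞ f) (e : E) (r : ℝ) :
    HasDerivAt (fun r : ℝ => r • fderiv ℝ f (r • e) e)
      (r • fderiv ℝ (fderiv ℝ f) (r • e) e e + fderiv ℝ f (r • e) e) r := by
  have fderiv_smooth : ContDiff ℝ ∞ (fderiv ℝ f) := hf.fderiv_right (by simp)
  have := hasDerivAt_comp_smul (fderiv_smooth.clm_apply (contDiff_const (c := e))) e r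
  rw [fderiv_clm_apply (fderiv_smooth.differentiable (by simp) _) (by fun_prop)] at this
  simpa using (hasDerivAt_id' r).fun_smul this

theorem isBigO_comp_smul (hf : ContDiff ℝ ∞ f) {N : ℕ} (hfN : VanishesToOrder N f) {e : E}
    (he : ‖e‖ = 1) : (fun r : ℝ => f (r • e)) =O[𝓝[>] 0] fun r => r ^ N := by
  have smul_tendsto : Tendsto (fun r : ℝ => r • e) (𝓝[>] 0) (𝓝 0) := by
    have : Continuous fun r : ℝ => r • e := by fun_prop
    simpa using (this.tendsto 0).mono_left nhdsWithin_le_nhds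
  simpa only [Function.comp_def, norm_smul, he, mul_one, ← norm_pow,
    Asymptotics.isBigO_norm_right] using (hfN.isBigO hf).comp_tendsto smul_tendsto

theorem isBigO_smul_fderiv_smul (hf : ContDiff ℝ ∞ f) {N : ℕ} (hfN : VanishesToOrder (N + 1) f)
    {e : E} (he : ‖e‖ = 1) :
    (fun r : ℝ => r • fderiv ℝ f (r • e) e) =O[𝓝[>] 0] fun r => r ^ N := by
  have fderiv_smooth : ContDiff ℝ ∞ (fderiv ℝ f) := hf.fderiv_right (by simp)
  have fderiv_vanishes : VanishesToOrder N fun y => fderiv ℝ f y e :=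
    (vanishesToOrder_succ_iff.1 hfN).2.clm_comp (.apply ℝ ℂ e) fderiv_smooth
  have id_bounded : (fun r : ℝ => r) =O[𝓝[>] 0] fun _ => (1 : ℝ) :=
    (tendsto_id.mono_left nhdsWithin_le_nhds).isBigO_one ℝ
  simpa using id_bounded.smul
    (isBigO_comp_smul (fderiv_smooth.clm_apply contDiff_const) fderiv_vanishes he)

theorem apply_eq_sum_repr {X ι : Type*} [Fintype ι] {W : Submodule ℂ (X → ℂ)} (b : Basis ι ℂ W)
    (f : W) (x : X) : (f : X → ℂ) x = ∑ i, b.repr f i * (b i : X → ℂ) x := by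
  conv_lhs => rw [← b.sum_repr f]
  simp only [Submodule.coe_sum, Submodule.coe_smul, Finset.sum_apply, Pi.smul_apply, smul_eq_mul]

/-- Rotation invariance turns the angular part of the Laplacian on a ray into an endomorphism `C` of
the finite-dimensional space `W`, so the equation becomes a linear system there. -/
theorem exists_radial_system [FiniteDimensional ℝ E]
    (invariant : ∀ f ∈ W, ∀ u : E ≃ₗᵢ[ℝ] E, f ∘ u ∈ W) (smooth : ∀ f ∈ W, ContDiff ℝ ∞ f)
    {V : ℝ → ℂ} (pde : ∀ f ∈ W, ∀ y, ‖y‖ ^ 2 • Laplacian.laplacian f y = V ‖y‖ * f y) {ι : Type*}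
    [Fintype ι] (b : Basis ι ℂ W) {e : E} (he : ‖e‖ = 1) :
    ∃ C : Matrix ι ι ℂ, ∀ (r : ℝ) (i : ι),
      r • (r • fderiv ℝ (fderiv ℝ (b i : E → ℂ)) (r • e) e e + fderiv ℝ (b i : E → ℂ) (r • e) e) =
        V |r| * (b i : E → ℂ) (r • e) - C.mulVec (fun j => (b j : E → ℂ) (r • e)) i +
          (2 - finrank ℝ E : ℝ) • r • fderiv ℝ (b i : E → ℂ) (r • e) e := by
  choose g hgW hg using fun i => exists_mem_laplacian_eq invariant smooth (b i).2 he
  refine ⟨.of fun i j => b.repr ⟨g i, hgW i⟩ j, fun r i => ?_⟩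
  have g_eq : g i (r • e) = ∑ j, b.repr ⟨g i, hgW i⟩ j * (b j : E → ℂ) (r • e) :=
    apply_eq_sum_repr b ⟨g i, hgW i⟩ _
  have radial := pde _ (b i).2 (r • e)
  rw [norm_smul, he, mul_one, Real.norm_eq_abs, sq_abs, hg i r, g_eq] at radial
  simp only [Matrix.mulVec, dotProduct, Matrix.of_apply, ← radial]
  module

theorem eq_zero_of_flat [FiniteDimensional ℝ E]
    (invariant : ∀ f ∈ W, ∀ u : E ≃ₗᵢ[ℝ] E, f ∘ u ∈ W) (smooth : ∀ f ∈ W, ContDiff ℝ ∞ f)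
    (flat : ∀ f ∈ W, ∀ N, VanishesToOrder N f) {V : ℝ → ℂ} (hV : Continuous V)
    (pde : ∀ f ∈ W, ∀ y, ‖y‖ ^ 2 • Laplacian.laplacian f y = V ‖y‖ * f y) (hf : f ∈ W) :
    f = 0 := by
  funext y
  rcases eq_or_ne y 0 with rfl | hy
  · exact (vanishesToOrder_succ_iff.1 (flat f hf 1)).1
  let e := ‖y‖⁻¹ • y
  have he : ‖e‖ = 1 := norm_smul_inv_norm hy
  let b := finBasis ℂ W
  have b_smooth (i) : ContDiff ℝ ∞ (b i : E → ℂ) := smooth _ (b i).2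
  obtain ⟨C, hC⟩ := exists_radial_system invariant smooth pde b he
  let X := Fin (finrank ℂ W) → ℂ
  let C' : X →L[ℝ] X := (C.mulVecLin.restrictScalars ℝ).toContinuousLinearMap
  let B (r : ℝ) : X × X →L[ℝ] X × X :=
    (ContinuousLinearMap.snd ℝ X X).prod (V |r| • .fst ℝ X X - C' ∘L .fst ℝ X X +
      (2 - finrank ℝ E : ℝ) • .snd ℝ X X)
  let p (r : ℝ) : X × X :=
    (fun i => (b i : E → ℂ) (r • e), fun i => r • fderiv ℝ (b i : E → ℂ) (r • e) e)
  have p_eq_zero : p ‖y‖ = 0 := by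
    refine eq_zero_of_flat_of_smul_deriv_eq (B := B) ?_
      (fun r => (hasDerivAt_pi.2 fun i => hasDerivAt_comp_smul (b_smooth i) e r).prodMk
        (hasDerivAt_pi.2 fun i => hasDerivAt_smul_fderiv_smul (b_smooth i) e r))
      (fun r => ?_) (fun N => ?_) (norm_pos_iff.2 hy)
    · exact (ContinuousLinearMap.prodₗᵢ ℝ (E := X × X)).continuous.comp
        (continuous_const.prodMk (by fun_prop))
    · exact Prod.ext rfl (funext fun i => hC r i)
    · exact (Asymptotics.isBigO_pi.2 fun i =>
        isBigO_comp_smul (b_smooth i) (flat _ (b i).2 N) he).prod_left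
        (Asymptotics.isBigO_pi.2 fun i =>
          isBigO_smul_fderiv_smul (b_smooth i) (flat _ (b i).2 (N + 1)) he)
  have b_apply (i) : (b i : E → ℂ) y = 0 := by
    have := congrFun (congrArg Prod.fst p_eq_zero) i
    simpa [p, e, smul_smul, norm_ne_zero_iff.2 hy] using this
  exact (apply_eq_sum_repr b ⟨f, hf⟩ y).trans (by simp [b_apply])

end InvariantSubspaces

section ExponentialDecomposition

open Module

theorem eq_exp_mul_of_hasDerivAt {f g : ℝ → ℂ} {μ c : ℂ}
    (hf : ∀ t, HasDerivAt f (μ * f t + g t) t) (hg : ∀ t, g t = Complex.exp (μ * t) * c) (t : ℝ) :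
    f t = Complex.exp (μ * t) * (f 0 + t * c) := by
  have hasDerivAt_exp : ∀ t : ℝ, HasDerivAt (fun t : ℝ => Complex.exp (-μ * t))
      (Complex.exp (-μ * t) * (-μ)) t := fun t => by
    simpa using (Complex.ofRealCLM.hasDerivAt.const_mul (-μ)).cexp
  have exp_neg_mul_exp : ∀ t : ℝ, Complex.exp (-μ * t) * Complex.exp (μ * t) = 1 := fun t => by
    rw [← Complex.exp_add, neg_mul, neg_add_cancel, Complex.exp_zero]
  have const : ∀ t, HasDerivAt (fun t : ℝ => Complex.exp (-μ * t) * f t - t * c) 0 t := fun t =>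
    ((hasDerivAt_exp t).mul (hf t)).sub (Complex.ofRealCLM.hasDerivAt.mul_const c)
      |>.congr_deriv <| by
      simp only [hg, Complex.ofRealCLM_apply, Complex.ofReal_one]
      linear_combination c * exp_neg_mul_exp t
  have := is_const_of_deriv_eq_zero (fun t => (const t).differentiableAt)
    (fun t => (const t).deriv) t 0
  simp only [Complex.ofReal_zero, mul_zero, Complex.exp_zero, one_mul, zero_mul, sub_zero] at this
  linear_combination Complex.exp (μ * t) * this - f t * exp_neg_mul_exp t

theorem eq_zero_of_periodic_of_hasDerivAt {f g : ℝ → ℂ} {μ : ℂ} {T : ℝ} (hT : T ≠ 0)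
    (hf : ∀ t, HasDerivAt f (μ * f t + g t) t) (hg : ∀ t, HasDerivAt g (μ * g t) t)
    (hfT : Function.Periodic f T) (hgT : Function.Periodic g T) : g = 0 := by
  have g_eq : ∀ t, g t = Complex.exp (μ * t) * g 0 := fun t => by
    simpa using eq_exp_mul_of_hasDerivAt (g := 0) (c := 0) (by simpa using hg) (by simp) t
  have f_eq := eq_exp_mul_of_hasDerivAt hf g_eq T
  by_contra hne
  have g_zero_ne : g 0 ≠ 0 := fun h => hne (funext fun t => by simp [g_eq t, h])
  have exp_eq_one : Complex.exp (μ * T) = 1 :=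
    mul_right_cancel₀ g_zero_ne (by rw [← g_eq, one_mul, hgT.eq])
  rw [exp_eq_one, one_mul, hfT.eq, left_eq_add] at f_eq
  exact g_zero_ne ((mul_eq_zero.1 f_eq).resolve_left (Complex.ofReal_ne_zero.2 hT))

variable {X : Type*} {W : Submodule ℂ (ℝ × X → ℂ)} [FiniteDimensional ℂ W]

/-- The derivative in the first variable, as an endomorphism of a finite dimensional translation
invariant space of functions that are differentiable in this variable. -/
def derivFst (translate : ∀ F ∈ W, ∀ α : ℝ, (fun p => F (p.1 + α, p.2)) ∈ W)
    (diff : ∀ F ∈ W, ∀ x, Differentiable ℝ fun t => F (t, x)) : End ℂ W where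
  toFun F := ⟨fun p => deriv (fun t => (F : ℝ × X → ℂ) (t, p.2)) p.1,
    deriv_mem_of_forall_mem (t := 0) (fun α => translate F F.2 α) fun p => by
      simpa using (diff F F.2 p.2 (p.1 + 0)).hasDerivAt.comp_const_add p.1 0⟩
  map_add' F G := Subtype.ext <| funext fun p => deriv_fun_add (diff F F.2 _ _) (diff G G.2 _ _)
  map_smul' c F := Subtype.ext <| funext fun p => deriv_const_mul c (diff F F.2 _ _)

variable (translate : ∀ F ∈ W, ∀ α : ℝ, (fun p => F (p.1 + α, p.2)) ∈ W)
  (diff : ∀ F ∈ W, ∀ x, Differentiable ℝ fun t => F (t, x))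

theorem hasDerivAt_slice_of_mem (F : W) (μ : ℂ) (x : X) (t : ℝ) :
    HasDerivAt (fun t => (F : ℝ × X → ℂ) (t, x))
      (μ * (F : ℝ × X → ℂ) (t, x) +
        (((derivFst translate diff - μ • 1) F : W) : ℝ × X → ℂ) (t, x)) t :=
  (diff F F.2 x t).hasDerivAt.congr_deriv <| by simp [derivFst]

theorem eq_exp_mul_of_mem_maxGenEigenspace {T : ℝ} (hT : T ≠ 0)
    (periodic : ∀ F ∈ W, ∀ x, Function.Periodic (fun t => F (t, x)) T) {μ : ℂ} {F : W}
    (hF : F ∈ (derivFst translate diff).maxGenEigenspace μ) (p : ℝ × X) :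
    (F : ℝ × X → ℂ) p = Complex.exp (μ * p.1) * (F : ℝ × X → ℂ) (0, p.2) := by
  set N := derivFst translate diff - μ • 1 with hN
  have hasDerivAt_slice := fun G => hasDerivAt_slice_of_mem translate diff G μ
  have ker_sq_le : ∀ G, N (N G) = 0 → N G = 0 := fun G hG => by
    ext ⟨t, x⟩
    refine congrFun (eq_zero_of_periodic_of_hasDerivAt hT (hasDerivAt_slice G x) (fun t => ?_)
      (periodic G G.2 x) (periodic (N G) (N G).2 x)) t
    simpa [← hN, hG] using hasDerivAt_slice (N G) x t
  have ker_eq : LinearMap.ker (N ^ 1) = LinearMap.ker (N ^ 2) := by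
    ext G
    simp only [LinearMap.mem_ker, pow_one, pow_two, End.mul_apply]
    exact ⟨fun hG => by rw [hG, map_zero], ker_sq_le G⟩
  obtain ⟨k, hk⟩ := (End.mem_maxGenEigenspace _ _ _).1 hF
  have hNF : N F = 0 := by
    have : F ∈ LinearMap.ker (N ^ (1 + k)) := by
      rw [LinearMap.mem_ker, pow_add, End.mul_apply, hk, map_zero]
    simpa [← End.ker_pow_constant ker_eq k] using this
  simpa using eq_exp_mul_of_hasDerivAt (c := 0) (fun t => hasDerivAt_slice F p.2 t)
    (by simp [← hN, hNF]) p.1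

theorem le_span_exp_mul {T : ℝ} (hT : T ≠ 0)
    (translate : ∀ F ∈ W, ∀ α : ℝ, (fun p => F (p.1 + α, p.2)) ∈ W)
    (diff : ∀ F ∈ W, ∀ x, Differentiable ℝ fun t => F (t, x))
    (periodic : ∀ F ∈ W, ∀ x, Function.Periodic (fun t => F (t, x)) T) :
    W ≤ Submodule.span ℂ {G | G ∈ W ∧ ∃ (μ : ℂ) (f : X → ℂ), Complex.exp (μ * T) = 1 ∧
      G = fun p => Complex.exp (μ * p.1) * f p.2} := by
  set S := Submodule.span ℂ {G | G ∈ W ∧ ∃ (μ : ℂ) (f : X → ℂ), Complex.exp (μ * T) = 1 ∧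
      G = fun p => Complex.exp (μ * p.1) * f p.2}
  suffices h : (⊤ : Submodule ℂ W) ≤ S.comap W.subtype from fun F hF => h (x := ⟨F, hF⟩) trivial
  rw [← End.iSup_maxGenEigenspace_eq_top (derivFst translate diff)]
  refine iSup_le fun μ F hF => ?_
  have F_eq := eq_exp_mul_of_mem_maxGenEigenspace translate diff hT periodic hF
  by_cases hzero : ∀ x, (F : ℝ × X → ℂ) (0, x) = 0
  · rw [show F = 0 from Subtype.ext (funext fun p => by simp [F_eq p, hzero])]
    exact Submodule.zero_mem _
  · push Not at hzero
    obtain ⟨x, hx⟩ := hzero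
    refine Submodule.subset_span ⟨F.2, μ, fun x => (F : ℝ × X → ℂ) (0, x), ?_, funext F_eq⟩
    exact mul_right_cancel₀ hx (by rw [← F_eq (T, x), one_mul, (periodic F F.2 x).eq])

end ExponentialDecomposition

section Kummer

open Filter Topology

/-- The coefficients of a power series that converges everywhere. -/
def IsEntireSeq (c : ℕ → ℂ) : Prop := ∀ z : ℂ, Summable fun j => c j * z ^ j

/-- The coefficients of the derivative of a power series. -/
def derivSeq (c : ℕ → ℂ) (j : ℕ) : ℂ := (j + 1) * c (j + 1)

theorem IsEntireSeq.summable_natCast_mul {c : ℕ → ℂ} (hc : IsEntireSeq c) (z : ℂ) :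
    Summable fun j : ℕ => j * c j * z ^ j := by
  refine (hc (2 * z)).norm.of_norm_bounded fun j => ?_
  have two_pow : (j : ℝ) ≤ 2 ^ j := by exact_mod_cast Nat.lt_two_pow_self.le
  rw [mul_assoc, norm_mul, mul_pow, mul_left_comm, norm_mul (2 ^ j : ℂ), norm_pow,
    Complex.norm_natCast, Complex.norm_ofNat]
  gcongr

theorem IsEntireSeq.derivSeq {c : ℕ → ℂ} (hc : IsEntireSeq c) : IsEntireSeq (derivSeq c) := by
  intro z
  rcases eq_or_ne z 0 with rfl | hz
  · exact summable_of_ne_finset_zero (s := {0}) fun j hj => by simp_all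
  · refine (summable_mul_left_iff hz).1 (((summable_nat_add_iff 1).2
      (hc.summable_natCast_mul z)).congr fun j => ?_)
    simp only [SingularSchrodinger.derivSeq, Nat.cast_add, Nat.cast_one]
    ring

theorem IsEntireSeq.hasSum_natCast_mul {c : ℕ → ℂ} (hc : IsEntireSeq c) (z : ℂ) :
    HasSum (fun j : ℕ => j * c j * z ^ j) (z * ∑' j, SingularSchrodinger.derivSeq c j * z ^ j) := by
  rw [← hasSum_nat_add_iff' 1, Finset.sum_range_one, Nat.cast_zero, zero_mul, zero_mul, sub_zero]
  refine ((hc.derivSeq z).hasSum.mul_left z).congr_fun fun j => ?_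
  simp only [SingularSchrodinger.derivSeq, Nat.cast_add, Nat.cast_one]
  ring

theorem IsEntireSeq.hasDerivAt {c : ℕ → ℂ} (hc : IsEntireSeq c) (z : ℂ) :
    HasDerivAt (fun w => ∑' j, c j * w ^ j) (∑' j, SingularSchrodinger.derivSeq c j * z ^ j) z := by
  set R : ℝ := ‖z‖ + 1 with hR
  have one_le_R : 1 ≤ R := by simp [hR]
  have termwise :
      HasDerivAt (fun w => ∑' j, c j * w ^ j) (∑' j : ℕ, c j * (j * z ^ (j - 1))) z := by
    refine hasDerivAt_tsum_of_isPreconnected (hc.summable_natCast_mul R).norm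
      Metric.isOpen_ball (convex_ball (0 : ℂ) R).isPreconnected
      (fun j w _ => (hasDerivAt_pow j w).const_mul (c j)) (fun j w hw => ?_)
      (Metric.mem_ball_self (by linarith)) (hc 0) (by simp [hR])
    rw [mem_ball_zero_iff] at hw
    have pow_le : ‖w‖ ^ (j - 1) ≤ R ^ j :=
      (pow_le_pow_left₀ (norm_nonneg _) hw.le _).trans
        (pow_le_pow_right₀ one_le_R (Nat.sub_le _ _))
    rw [mul_left_comm, ← mul_assoc, norm_mul, norm_mul _ ((R : ℂ) ^ j), norm_pow, norm_pow,
      Complex.norm_of_nonneg (by linarith)]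
    gcongr
  have shift : HasSum (fun j : ℕ => c j * (j * z ^ (j - 1)))
      (∑' j, SingularSchrodinger.derivSeq c j * z ^ j) := by
    rw [← hasSum_nat_add_iff' 1, Finset.sum_range_one, Nat.cast_zero, zero_mul, mul_zero, sub_zero]
    refine (hc.derivSeq z).hasSum.congr_fun fun j => ?_
    simp only [SingularSchrodinger.derivSeq, Nat.cast_add, Nat.cast_one, Nat.add_sub_cancel]
    ring
  rwa [shift.tsum_eq] at termwise

/-- The coefficients of Kummer's function `₁F₁(a, b, ·)`. -/
def kummerCoeff (a b : ℂ) (j : ℕ) : ℂ :=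
  (ascPochhammer ℂ j).eval a / ((ascPochhammer ℂ j).eval b * (j.factorial : ℂ))

variable {a b : ℂ}

theorem kummerCoeff_succ (a : ℂ) (hb : ∀ j : ℕ, b + j ≠ 0) (j : ℕ) :
    ((j : ℂ) + 1) * (b + j) * kummerCoeff a b (j + 1) = (a + j) * kummerCoeff a b j := by
  have pochhammer_ne_zero : ∀ i : ℕ, (ascPochhammer ℂ i).eval b ≠ 0 := by
    intro i
    induction i with
    | zero => simp
    | succ i ih => rw [ascPochhammer_succ_eval]; exact mul_ne_zero ih (hb i)
  have := pochhammer_ne_zero j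
  have := hb j
  have := Nat.cast_add_one_ne_zero (R := ℂ) j
  have : (j.factorial : ℂ) ≠ 0 := Nat.cast_ne_zero.2 j.factorial_ne_zero
  simp only [kummerCoeff, ascPochhammer_succ_eval, Nat.factorial_succ, Nat.cast_mul, Nat.cast_add,
    Nat.cast_one]
  field_simp

theorem isEntireSeq_kummerCoeff (a : ℂ) (hb : ∀ j : ℕ, b + j ≠ 0) :
    IsEntireSeq (kummerCoeff a b) := by
  intro z
  have ratio_tendsto : Tendsto (fun j : ℕ => ‖(a + 1 * j) / (b + 1 * j) * (1 / ((j : ℂ) + 1)) * z‖)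
      atTop (𝓝 0) := by
    simpa using (((tendsto_add_mul_div_add_mul_atTop_nhds a b 1 one_ne_zero).mul
      (tendsto_one_div_add_atTop_nhds_zero_nat (𝕜 := ℂ))).mul_const z).norm
  refine summable_of_ratio_norm_eventually_le (r := 1 / 2) (by norm_num) ?_
  filter_upwards [ratio_tendsto.eventually_le_const (by norm_num : (0 : ℝ) < 1 / 2)] with j hj
  have recurrence : kummerCoeff a b (j + 1) * z ^ (j + 1) =
      (a + 1 * j) / (b + 1 * j) * (1 / ((j : ℂ) + 1)) * z * (kummerCoeff a b j * z ^ j) := by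
    have := hb j
    have := Nat.cast_add_one_ne_zero (R := ℂ) j
    rw [one_mul]
    field_simp
    linear_combination z ^ (j + 1) * kummerCoeff_succ a hb j
  rw [recurrence, norm_mul]
  gcongr

theorem differentiable_kummer (a : ℂ) (hb : ∀ j : ℕ, b + j ≠ 0) :
    Differentiable ℂ (kummer a b) :=
  fun z => ((isEntireSeq_kummerCoeff a hb).hasDerivAt z).differentiableAt

theorem kummer_zero (a b : ℂ) : kummer a b 0 = 1 := by
  rw [kummer, tsum_eq_single 0 fun j hj => by simp [hj]]
  simp

theorem kummer_ode (a : ℂ) (hb : ∀ j : ℕ, b + j ≠ 0) (z : ℂ) :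
    z * deriv (deriv (kummer a b)) z + (b - z) * deriv (kummer a b) z - a * kummer a b z = 0 := by
  set c := kummerCoeff a b
  have entire : IsEntireSeq c := isEntireSeq_kummerCoeff a hb
  have deriv_eq : deriv (kummer a b) = fun w => ∑' j, derivSeq c j * w ^ j :=
    funext fun w => (entire.hasDerivAt w).deriv
  have deriv_deriv_eq : deriv (deriv (kummer a b)) z = ∑' j, derivSeq (derivSeq c) j * z ^ j := by
    rw [deriv_eq, (entire.derivSeq.hasDerivAt z).deriv]
  have expansion := (((entire.derivSeq.hasSum_natCast_mul z).add
    ((entire.derivSeq z).hasSum.mul_left b)).sub (entire.hasSum_natCast_mul z)).sub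
    ((entire z).hasSum.mul_left a)
  have coefficient_eq_zero : ∀ j : ℕ, j * derivSeq c j * z ^ j + b * (derivSeq c j * z ^ j) -
      j * c j * z ^ j - a * (c j * z ^ j) = 0 := fun j => by
    simp only [derivSeq]
    linear_combination z ^ j * kummerCoeff_succ a hb j
  simp only [coefficient_eq_zero] at expansion
  rw [deriv_deriv_eq, deriv_eq, show kummer a b z = ∑' j, c j * z ^ j from rfl]
  linear_combination expansion.unique hasSum_zero

end Kummer

section FourierTensor

variable {n : ℕ} {m : ℤ} {q : ZMod 4} {f : EuclideanSpace ℝ (Fin n) → ℂ}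

/-- The function `e^{-imθ/2} f(y)`, a vector of weight `m` for the action of the circle `K₂`. -/
def fourierTensor (m : ℤ) : (EuclideanSpace ℝ (Fin n) → ℂ) →ₗ[ℂ] Fn n where
  toFun f p := Complex.exp (-(Complex.I * m * p.1) / 2) * f p.2
  map_add' _ _ := funext fun _ => mul_add _ _ _
  map_smul' _ _ := funext fun _ => mul_left_comm _ _ _

theorem fourierTensor_apply (m : ℤ) (f : EuclideanSpace ℝ (Fin n) → ℂ)
    (p : ℝ × EuclideanSpace ℝ (Fin n)) :
    fourierTensor m f p = Complex.exp (-(Complex.I * m * p.1) / 2) * f p.2 := rfl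

theorem fourierTensor_injective (m : ℤ) : Function.Injective (fourierTensor (n := n) m) :=
  fun f g h => funext fun y => by simpa [fourierTensor_apply] using congrFun h (0, y)

theorem contDiff_fourierTensor_iff : ContDiff ℝ ∞ (fourierTensor m f) ↔ ContDiff ℝ ∞ f := by
  refine ⟨fun h => ?_, fun h => ?_⟩
  · simpa [Function.comp_def, fourierTensor_apply] using
      h.comp (contDiff_const (c := (0 : ℝ)).prodMk contDiff_id)
  · have ofReal_fst : ContDiff ℝ ∞ fun p : ℝ × EuclideanSpace ℝ (Fin n) => (p.1 : ℂ) :=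
      Complex.ofRealCLM.contDiff.comp contDiff_fst
    exact (((contDiff_const.mul ofReal_fst).neg).div_const 2).cexp.mul (h.comp contDiff_snd)

theorem OmegaOp_fourierTensor (s : ℂ) (m : ℤ) (hf : ContDiff ℝ ∞ f) :
    OmegaOp n s (fourierTensor m f) = fourierTensor m fun y =>
      ((‖y‖ ^ 2 : ℝ) : ℂ) * ((4 * s ^ 2 * ((‖y‖ ^ 2 : ℝ) : ℂ) - 2 * Complex.I * m * s) * f y +
        Laplacian.laplacian f y) := by
  funext p
  have exponent_deriv : HasDerivAt (fun t : ℝ => -(Complex.I * m * t) / 2)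
      (-(Complex.I * m) / 2) p.1 := by
    simpa using ((Complex.ofRealCLM.hasDerivAt (x := p.1)).const_mul (Complex.I * m)).fun_neg
      |>.div_const 2
  have theta_deriv : deriv (fun t : ℝ => fourierTensor m f (t, p.2)) p.1 =
      Complex.exp (-(Complex.I * m * p.1) / 2) * (-(Complex.I * m) / 2) * f p.2 :=
    (exponent_deriv.cexp.mul_const (f p.2)).deriv
  have laplacian_slice : Laplacian.laplacian (fun y => fourierTensor m f (p.1, y)) p.2 =
      Complex.exp (-(Complex.I * m * p.1) / 2) * Laplacian.laplacian f p.2 :=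
    InnerProductSpace.laplacian_smul (Complex.exp (-(Complex.I * m * p.1) / 2))
      (contDiff_infty.1 hf 2).contDiffAt
  simp only [OmegaOp, theta_deriv, laplacian_slice]
  simp only [fourierTensor_apply]
  ring

theorem fourierTensor_add_int_mul_pi (m j : ℤ) (f : EuclideanSpace ℝ (Fin n) → ℂ) (θ : ℝ)
    (y : EuclideanSpace ℝ (Fin n)) :
    fourierTensor m f (θ + j * Real.pi, y) = Complex.I ^ (-(m * j)) * fourierTensor m f (θ, y) := by
  simp only [fourierTensor_apply]
  nth_rw 2 [← Complex.exp_pi_div_two_mul_I]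
  rw [← Complex.exp_int_mul, ← mul_assoc, ← Complex.exp_add]
  congr 2
  push_cast
  ring

theorem apply_neg_one_zpow_smul {c : ℂ} (hc : c ≠ 0) (hf : ∀ y, f (-y) = c * f y) (j : ℤ)
    (y : EuclideanSpace ℝ (Fin n)) : f ((-1 : ℝ) ^ j • y) = c ^ j * f y := by
  have step : ∀ i : ℤ, f ((-1 : ℝ) ^ (i + 1) • y) = c * f ((-1 : ℝ) ^ i • y) := fun i => by
    rw [zpow_add_one₀ (by norm_num), mul_neg_one, neg_smul, hf]
  induction j with
  | zero => simp
  | succ i ih => rw [step, ih, zpow_add_one₀ hc]; ring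
  | pred i ih =>
    rw [zpow_sub_one₀ hc, mul_right_comm, ← ih, ← sub_add_cancel (-(i : ℤ)) 1, step,
      sub_add_cancel]
    field_simp

theorem fourierTensor_mem_compactPicture_iff :
    fourierTensor m f ∈ compactPicture n q ↔
      ContDiff ℝ ∞ f ∧ ∀ y, f (-y) = Complex.I ^ (m - (q.val : ℤ)) * f y := by
  have I_zpow_mul : ∀ j : ℤ, Complex.I ^ (-(m * j)) * (Complex.I ^ (m - (q.val : ℤ))) ^ j =
      Complex.I ^ (-(j * (q.val : ℤ))) := fun j => by
    rw [← zpow_mul, ← zpow_add₀ Complex.I_ne_zero]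
    congr 1
    ring
  have equivariant_iff : ∀ (j : ℤ) (θ : ℝ) y,
      fourierTensor m f (θ + j * Real.pi, (-1 : ℝ) ^ j • y) =
        Complex.I ^ (-(j * (q.val : ℤ))) * fourierTensor m f (θ, y) ↔
      f ((-1 : ℝ) ^ j • y) = (Complex.I ^ (m - (q.val : ℤ))) ^ j * f y := fun j θ y => by
    rw [fourierTensor_add_int_mul_pi, ← I_zpow_mul, mul_assoc,
      mul_right_inj' (zpow_ne_zero _ Complex.I_ne_zero), fourierTensor_apply, fourierTensor_apply,
      mul_left_comm, mul_right_inj' (Complex.exp_ne_zero _)]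
  refine and_congr contDiff_fourierTensor_iff ⟨fun h y => ?_, fun h j θ y => ?_⟩
  · simpa using (equivariant_iff 1 0 y).1 (h 1 0 y)
  · exact (equivariant_iff j θ y).2
      (apply_neg_one_zpow_smul (zpow_ne_zero _ Complex.I_ne_zero) h j y)

theorem I_zpow_sub_val_eq_neg_one_pow_iff (m : ℤ) (q : ZMod 4) (k : ℕ) :
    Complex.I ^ (m - (q.val : ℤ)) = (-1) ^ k ↔ (m : ZMod 4) = 2 * (k : ZMod 4) + q := by
  have neg_one_pow_eq : (-1 : ℂ) ^ k = Complex.I ^ (2 * k : ℤ) := by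
    rw [zpow_mul, zpow_natCast, zpow_ofNat, Complex.I_sq]
  rw [neg_one_pow_eq, ← div_eq_one_iff_eq (zpow_ne_zero _ Complex.I_ne_zero),
    ← zpow_sub₀ Complex.I_ne_zero, Complex.isPrimitiveRoot_I.zpow_eq_one_iff_dvd,
    ← ZMod.intCast_zmod_eq_zero_iff_dvd]
  push_cast
  rw [ZMod.natCast_zmod_val, sub_sub, sub_eq_zero, add_comm q]

end FourierTensor

section KAction

variable {n : ℕ} {F : Fn n} {q : ZMod 4} {s lam : ℂ}

theorem laplacian_comp_isometry {E F : Type*} [NormedAddCommGroup E] [InnerProductSpace ℝ E]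
    [FiniteDimensional ℝ E] [NormedAddCommGroup F] [NormedSpace ℝ F] {f : E → F}
    (hf : ContDiff ℝ 2 f) (u : E ≃ₗᵢ[ℝ] E) (y : E) :
    Laplacian.laplacian (f ∘ u) y = Laplacian.laplacian f (u y) := by
  rw [InnerProductSpace.laplacian_eq_iteratedFDeriv_orthonormalBasis _ (stdOrthonormalBasis ℝ E),
    InnerProductSpace.laplacian_eq_iteratedFDeriv_orthonormalBasis f
      ((stdOrthonormalBasis ℝ E).map u)]
  refine Finset.sum_congr rfl fun i _ => ?_
  have chain := (u.toContinuousLinearEquiv : E →L[ℝ] E).iteratedFDeriv_comp_right hf y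
    (i := 2) le_rfl
  rw [show f ∘ u = f ∘ (u.toContinuousLinearEquiv : E →L[ℝ] E) from rfl, chain,
    ContinuousMultilinearMap.compContinuousLinearMap_apply]
  congr 1
  funext j
  fin_cases j <;> simp

theorem kAct_apply (α : ℝ) (u : EuclideanSpace ℝ (Fin n) ≃ₗᵢ[ℝ] EuclideanSpace ℝ (Fin n))
    (F : Fn n) (p : ℝ × EuclideanSpace ℝ (Fin n)) :
    kAct n α u F p = F (p.1 - α, u.symm p.2) := rfl

theorem kAct_mem_compactPicture (hF : F ∈ compactPicture n q) (α : ℝ)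
    (u : EuclideanSpace ℝ (Fin n) ≃ₗᵢ[ℝ] EuclideanSpace ℝ (Fin n)) :
    kAct n α u F ∈ compactPicture n q := by
  refine ⟨hF.1.comp ((contDiff_fst.sub contDiff_const).prodMk
    (u.symm.contDiff.comp contDiff_snd)), fun j θ y => ?_⟩
  simp only [kAct_apply]
  rw [map_smul, add_sub_right_comm]
  exact hF.2 j (θ - α) (u.symm y)

theorem OmegaOp_kAct (hF : ContDiff ℝ ∞ F) (α : ℝ)
    (u : EuclideanSpace ℝ (Fin n) ≃ₗᵢ[ℝ] EuclideanSpace ℝ (Fin n)) :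
    OmegaOp n s (kAct n α u F) = kAct n α u (OmegaOp n s F) := by
  funext p
  have theta_deriv : deriv (fun t : ℝ => F (t - α, u.symm p.2)) p.1 =
      deriv (fun t : ℝ => F (t, u.symm p.2)) (p.1 - α) :=
    deriv_comp_sub_const (fun t : ℝ => F (t, u.symm p.2)) α p.1
  have laplacian_slice := laplacian_comp_isometry (contDiff_slice_snd hF (p.1 - α)) u.symm p.2
  simp only [Function.comp_def] at laplacian_slice
  simp only [OmegaOp, kAct_apply, theta_deriv, laplacian_slice, LinearIsometryEquiv.norm_map]

theorem kAct_kAct (α β : ℝ) (u v : EuclideanSpace ℝ (Fin n) ≃ₗᵢ[ℝ] EuclideanSpace ℝ (Fin n))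
    (F : Fn n) : kAct n β v (kAct n α u F) = kAct n (β + α) (u.trans v) F := by
  funext p
  simp only [kAct_apply, sub_sub, LinearIsometryEquiv.symm_trans, LinearIsometryEquiv.coe_trans,
    Function.comp_apply]

theorem kAct_mem_kSpan_of_mem {G : Fn n} (hG : G ∈ kSpan n F) (α : ℝ)
    (u : EuclideanSpace ℝ (Fin n) ≃ₗᵢ[ℝ] EuclideanSpace ℝ (Fin n)) :
    kAct n α u G ∈ kSpan n F := by
  suffices kSpan n F ≤ (kSpan n F).comap (kAct n α u) from this hG
  refine Submodule.span_le.2 ?_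
  rintro _ ⟨⟨β, v⟩, rfl⟩
  exact Submodule.subset_span ⟨(α + β, v.trans u), (kAct_kAct β α v u F).symm⟩

theorem kSpan_le_of_mem {G : Fn n} (hG : G ∈ kSpan n F) : kSpan n G ≤ kSpan n F :=
  Submodule.span_le.2 <| Set.range_subset_iff.2 fun g => kAct_mem_kSpan_of_mem hG g.1 g.2

theorem mem_kSpan_self (F : Fn n) : F ∈ kSpan n F :=
  Submodule.subset_span ⟨(0, LinearIsometryEquiv.refl ℝ _), by
    funext p
    change F (p.1 - 0, p.2) = F p
    rw [sub_zero]⟩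

theorem kSpan_le_kerOmegaK (hF : F ∈ kerOmegaK n q s lam) : kSpan n F ≤ kerOmegaK n q s lam := by
  refine Submodule.span_le.2 (Set.range_subset_iff.2 fun ⟨α, u⟩ => ?_)
  obtain ⟨⟨mem, eigen⟩, finite⟩ := hF
  have : FiniteDimensional ℂ (kSpan n F) := finite
  refine ⟨⟨kAct_mem_compactPicture mem α u, ?_⟩, Submodule.finiteDimensional_of_le
    (kSpan_le_of_mem (kAct_mem_kSpan_of_mem (mem_kSpan_self F) α u))⟩
  rw [OmegaOp_kAct mem.1, eigen, map_smul]

theorem periodic_of_mem_compactPicture (hF : F ∈ compactPicture n q)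
    (y : EuclideanSpace ℝ (Fin n)) : Function.Periodic (fun θ => F (θ, y)) (4 * Real.pi) := by
  intro θ
  have I_zpow : Complex.I ^ (-(4 * (q.val : ℤ))) = 1 :=
    (Complex.isPrimitiveRoot_I.zpow_eq_one_iff_dvd _).2 ⟨-(q.val : ℤ), by push_cast; ring⟩
  have equivariance := hF.2 4 θ y
  rw [I_zpow, one_mul, (by decide : Even (4 : ℤ)).neg_one_zpow, one_smul] at equivariance
  exact_mod_cast equivariance

theorem kerOmegaK_le_of_fourierTensor_mem {S : Submodule ℂ (Fn n)}
    (hS : ∀ m f, fourierTensor m f ∈ kerOmegaK n q s lam → fourierTensor m f ∈ S) :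
    kerOmegaK n q s lam ≤ S := by
  intro F hF
  have : FiniteDimensional ℂ (kSpan n F) := hF.2
  have kSpan_le := kSpan_le_kerOmegaK hF
  refine Submodule.span_le.2 ?_ <| le_span_exp_mul (W := kSpan n F) (T := 4 * Real.pi)
    (by positivity) (fun G hG α => ?_)
    (fun G hG y => (contDiff_slice_fst (kSpan_le hG).1.1.1 y).differentiable (by simp))
    (fun G hG y => periodic_of_mem_compactPicture (kSpan_le hG).1.1 y) (mem_kSpan_self F)
  · rintro _ ⟨hG, μ, f, hμ, rfl⟩
    obtain ⟨m, hm⟩ := Complex.exp_eq_one_iff.1 hμ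
    have exponent_eq : μ = -(Complex.I * ((-m : ℤ) : ℂ)) / 2 := by
      have := Complex.ofReal_ne_zero.2 Real.pi_ne_zero
      refine mul_right_cancel₀ this ?_
      push_cast at hm ⊢
      linear_combination hm / 4
    have eq_fourierTensor : (fun p => Complex.exp (μ * p.1) * f p.2) = fourierTensor (-m) f := by
      funext p
      rw [fourierTensor_apply, exponent_eq]
      ring_nf
    rw [eq_fourierTensor] at hG ⊢
    exact hS _ _ (kSpan_le hG)
  · convert kAct_mem_kSpan_of_mem hG (-α) (LinearIsometryEquiv.refl ℝ _) using 2
    rw [kAct_apply, sub_neg_eq_add]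
    rfl

/-- The span of the translates of a function under the orthogonal group. -/
def rotationSpan (f : EuclideanSpace ℝ (Fin n) → ℂ) : Submodule ℂ (EuclideanSpace ℝ (Fin n) → ℂ) :=
  Submodule.span ℂ (Set.range fun u : EuclideanSpace ℝ (Fin n) ≃ₗᵢ[ℝ] EuclideanSpace ℝ (Fin n) =>
    f ∘ u)

theorem kAct_fourierTensor (α : ℝ)
    (u : EuclideanSpace ℝ (Fin n) ≃ₗᵢ[ℝ] EuclideanSpace ℝ (Fin n)) (m : ℤ)
    (f : EuclideanSpace ℝ (Fin n) → ℂ) : kAct n α u (fourierTensor m f) =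
      Complex.exp (Complex.I * m * α / 2) • fourierTensor m (f ∘ u.symm) := by
  funext p
  rw [Pi.smul_apply, smul_eq_mul, kAct_apply, fourierTensor_apply, fourierTensor_apply,
    ← mul_assoc, ← Complex.exp_add]
  congr 2
  push_cast
  ring

theorem kSpan_fourierTensor (m : ℤ) (f : EuclideanSpace ℝ (Fin n) → ℂ) :
    kSpan n (fourierTensor m f) = (rotationSpan f).map (fourierTensor m) := by
  rw [rotationSpan, Submodule.map_span]
  refine le_antisymm (Submodule.span_le.2 ?_) (Submodule.span_le.2 ?_)
  · rintro _ ⟨⟨α, u⟩, rfl⟩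
    simp only [kAct_fourierTensor]
    exact Submodule.smul_mem _ _ (Submodule.subset_span ⟨_, ⟨u.symm, rfl⟩, rfl⟩)
  · rintro _ ⟨_, ⟨u, rfl⟩, rfl⟩
    exact Submodule.subset_span ⟨(0, u.symm), by simp [kAct_fourierTensor]⟩

theorem isKFinite_fourierTensor_iff (m : ℤ) (f : EuclideanSpace ℝ (Fin n) → ℂ) :
    IsKFinite n (fourierTensor m f) ↔ FiniteDimensional ℂ (rotationSpan f) := by
  rw [IsKFinite, kSpan_fourierTensor]
  exact Module.Finite.equiv_iff
    (Submodule.equivMapOfInjective _ (fourierTensor_injective m) _).symm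

end KAction

section RadialFunctions

open MvPolynomial

variable {n : ℕ} {f g : EuclideanSpace ℝ (Fin n) → ℂ} {φ : ℂ → ℂ}

theorem laplacian_mul (hf : ContDiff ℝ ∞ f) (hg : ContDiff ℝ ∞ g) :
    Laplacian.laplacian (f * g) = Laplacian.laplacian f * g +
      2 * ∑ i, partialDeriv i f * partialDeriv i g + f * Laplacian.laplacian g := by
  have differentiable {h : EuclideanSpace ℝ (Fin n) → ℂ} (hh : ContDiff ℝ ∞ h) :
      Differentiable ℝ h := hh.differentiable (by simp)
  have leibniz (i : Fin n) : partialDeriv i (partialDeriv i (f * g)) =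
      partialDeriv i (partialDeriv i f) * g + 2 * (partialDeriv i f * partialDeriv i g) +
        f * partialDeriv i (partialDeriv i g) := by
    have hfi := contDiff_partialDeriv hf i
    have hgi := contDiff_partialDeriv hg i
    rw [partialDeriv_mul (differentiable hf) (differentiable hg),
      partialDeriv_add (f := partialDeriv i f * g) (g := f * partialDeriv i g)
        (differentiable (hfi.mul hg)) (differentiable (hf.mul hgi)),
      partialDeriv_mul (differentiable hfi) (differentiable hg),
      partialDeriv_mul (differentiable hf) (differentiable hgi)]
    ring
  simp only [laplacian_eq_sum_partialDeriv (f := f * g) (hf.mul hg),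
    laplacian_eq_sum_partialDeriv hf, laplacian_eq_sum_partialDeriv hg, leibniz,
    Finset.sum_add_distrib, Finset.sum_mul, Finset.mul_sum]

theorem contDiff_comp_polyFun (hφ : Differentiable ℂ φ) (Q : MvPolynomial (Fin n) ℂ) :
    ContDiff ℝ ∞ (φ ∘ polyFun Q) :=
  (hφ.contDiff.restrict_scalars ℝ).comp (contDiff_polyFun Q)

theorem partialDeriv_comp_polyFun (hφ : Differentiable ℂ φ) (i : Fin n)
    (Q : MvPolynomial (Fin n) ℂ) :
    partialDeriv i (φ ∘ polyFun Q) = (deriv φ ∘ polyFun Q) * polyFun (pderiv i Q) := by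
  funext y
  have chain := (hφ (polyFun Q y)).hasDerivAt.comp_hasFDerivAt y
    ((contDiff_polyFun Q).differentiable (by simp) y).hasFDerivAt
  rw [partialDeriv, chain.fderiv, ← partialDeriv_polyFun]
  rfl

theorem laplacian_comp_normSqPoly (hφ : Differentiable ℂ φ) :
    Laplacian.laplacian (φ ∘ polyFun (normSqPoly (Fin n) ℂ)) =
      4 * (polyFun (normSqPoly (Fin n) ℂ) * (deriv (deriv φ) ∘ polyFun (normSqPoly (Fin n) ℂ))) +
        2 * (n : EuclideanSpace ℝ (Fin n) → ℂ) *
          (deriv φ ∘ polyFun (normSqPoly (Fin n) ℂ)) := by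
  have hφ' : Differentiable ℂ (deriv φ) := hφ.deriv
  have pderiv_two_mul_X (i : Fin n) : pderiv i (2 * X i : MvPolynomial (Fin n) ℂ) = 2 := by
    rw [← map_ofNat (C : ℂ →+* MvPolynomial (Fin n) ℂ) 2, pderiv_C_mul, pderiv_X_self, mul_one]
  have second_derivative (i : Fin n) :
      partialDeriv i (partialDeriv i (φ ∘ polyFun (normSqPoly (Fin n) ℂ))) =
        4 * (polyFun (X i ^ 2) * (deriv (deriv φ) ∘ polyFun (normSqPoly (Fin n) ℂ))) +
          2 * (deriv φ ∘ polyFun (normSqPoly (Fin n) ℂ)) := by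
    rw [partialDeriv_comp_polyFun hφ, partialDeriv_mul
      ((contDiff_comp_polyFun hφ' _).differentiable (by simp))
      ((contDiff_polyFun _).differentiable (by simp)), partialDeriv_comp_polyFun hφ',
      partialDeriv_polyFun, pderiv_normSqPoly, pderiv_two_mul_X]
    simp only [map_mul, map_pow, map_ofNat]
    ring
  rw [laplacian_eq_sum_partialDeriv (contDiff_comp_polyFun hφ _)]
  simp only [second_derivative, Finset.sum_add_distrib, ← Finset.mul_sum, ← Finset.sum_mul,
    ← map_sum, Finset.sum_const, Finset.card_univ, Fintype.card_fin, nsmul_eq_mul]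
  rw [normSqPoly]
  ring

theorem laplacian_comp_normSqPoly_mul_polyFun (hφ : Differentiable ℂ φ) {d : ℕ}
    {H : MvPolynomial (Fin n) ℂ} (hH : H.IsHomogeneous d) :
    Laplacian.laplacian ((φ ∘ polyFun (normSqPoly (Fin n) ℂ)) * polyFun H) =
      (4 * (polyFun (normSqPoly (Fin n) ℂ) * (deriv (deriv φ) ∘ polyFun (normSqPoly (Fin n) ℂ))) +
        (2 * (n : EuclideanSpace ℝ (Fin n) → ℂ) + 4 * (d : EuclideanSpace ℝ (Fin n) → ℂ)) *
          (deriv φ ∘ polyFun (normSqPoly (Fin n) ℂ))) * polyFun H +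
        (φ ∘ polyFun (normSqPoly (Fin n) ℂ)) * polyFun (lapPoly (Fin n) ℂ H) := by
  have euler : ∑ i, polyFun (X i) * polyFun (pderiv i H) =
      (d : EuclideanSpace ℝ (Fin n) → ℂ) * polyFun H := by
    rw [← nsmul_eq_mul, ← map_nsmul, ← hH.sum_X_mul_pderiv, map_sum]
    simp only [map_mul]
  have gradient_mul_gradient :
      ∑ i, partialDeriv i (φ ∘ polyFun (normSqPoly (Fin n) ℂ)) * partialDeriv i (polyFun H) =
        2 * (deriv φ ∘ polyFun (normSqPoly (Fin n) ℂ)) * (d * polyFun H) := by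
    rw [← euler, Finset.mul_sum]
    refine Finset.sum_congr rfl fun i _ => ?_
    rw [partialDeriv_comp_polyFun hφ, partialDeriv_polyFun, pderiv_normSqPoly, map_mul, map_ofNat]
    ring
  rw [laplacian_mul (contDiff_comp_polyFun hφ _) (contDiff_polyFun H), laplacian_comp_normSqPoly hφ,
    gradient_mul_gradient, laplacian_polyFun]
  ring

end RadialFunctions

section Solutions

open MvPolynomial

theorem normSqPoly_mul_lapPoly_normSqPoly_pow_mul {σ R : Type*} [Fintype σ] [CommRing R] {k : ℕ}
    {h : MvPolynomial σ R} (hh : h.IsHomogeneous k) (harmonic : lapPoly σ R h = 0) (l : ℕ) :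
    normSqPoly σ R * lapPoly σ R (normSqPoly σ R ^ l * h) =
      (2 * ((l : R) * (2 * (l : R) + 2 * (k : R) + (Fintype.card σ : R) - 2))) •
        (normSqPoly σ R ^ l * h) := by
  induction l with
  | zero => simp [harmonic]
  | succ l ih =>
    rw [pow_succ', mul_assoc, lapPoly_normSqPoly_mul ((isHomogeneous_normSqPoly.pow l).mul hh), ih,
      ← add_smul, mul_smul_comm]
    congr 1
    push_cast
    ring

/-- The radial factor `e^{-isw} ₁F₁(a, b, 2isw)` of a solution, as a function of `w = ‖y‖²`. -/
def radialFactor (s a b w : ℂ) : ℂ :=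
  Complex.exp (-(Complex.I * s * w)) * kummer a b (2 * Complex.I * s * w)

theorem radialFactor_zero (s a b : ℂ) : radialFactor s a b 0 = 1 := by
  simp [radialFactor, kummer_zero]

theorem hasDerivAt_exp_mul_comp {G : ℂ → ℂ} (hG : Differentiable ℂ G) (s w : ℂ) :
    HasDerivAt (fun w => Complex.exp (-(Complex.I * s * w)) * G (2 * Complex.I * s * w))
      (Complex.exp (-(Complex.I * s * w)) * (-(Complex.I * s) * G (2 * Complex.I * s * w) +
        2 * Complex.I * s * deriv G (2 * Complex.I * s * w))) w := by
  have exp_deriv : HasDerivAt (fun w => Complex.exp (-(Complex.I * s * w)))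
      (Complex.exp (-(Complex.I * s * w)) * (-(Complex.I * s))) w := by
    simpa using (((hasDerivAt_id w).const_mul (Complex.I * s)).fun_neg).cexp
  have comp_deriv : HasDerivAt (fun w => G (2 * Complex.I * s * w))
      (deriv G (2 * Complex.I * s * w) * (2 * Complex.I * s)) w :=
    (hG _).hasDerivAt.comp w (by simpa using (hasDerivAt_id w).const_mul (2 * Complex.I * s))
  refine (exp_deriv.mul comp_deriv).congr_deriv ?_
  ring

variable {b : ℂ}

theorem differentiable_radialFactor (s a : ℂ) (hb : ∀ j : ℕ, b + j ≠ 0) :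
    Differentiable ℂ (radialFactor s a b) := fun w =>
  (hasDerivAt_exp_mul_comp (differentiable_kummer a hb) s w).differentiableAt

theorem radialFactor_ode (s m w : ℂ) (hb : ∀ j : ℕ, b + j ≠ 0) :
    w * deriv (deriv (radialFactor s (b / 2 + m / 4) b)) w +
      b * deriv (radialFactor s (b / 2 + m / 4) b) w +
      (s ^ 2 * w - Complex.I * m * s / 2) * radialFactor s (b / 2 + m / 4) b w = 0 := by
  set M := kummer (b / 2 + m / 4) b with hM
  have differentiable_M : Differentiable ℂ M := differentiable_kummer _ hb
  have deriv_eq : deriv (radialFactor s (b / 2 + m / 4) b) = fun w =>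
      -(Complex.I * s) * (Complex.exp (-(Complex.I * s * w)) * M (2 * Complex.I * s * w)) +
        2 * Complex.I * s *
          (Complex.exp (-(Complex.I * s * w)) * deriv M (2 * Complex.I * s * w)) := by
    funext w
    have : deriv (radialFactor s (b / 2 + m / 4) b) w = _ :=
      (hasDerivAt_exp_mul_comp differentiable_M s w).deriv
    rw [this]
    ring
  have deriv_deriv_eq :=
    (((hasDerivAt_exp_mul_comp differentiable_M s w).const_mul (-(Complex.I * s))).fun_add
      ((hasDerivAt_exp_mul_comp differentiable_M.deriv s w).const_mul (2 * Complex.I * s))).deriv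
  rw [deriv_eq, deriv_deriv_eq]
  have kummer_equation := kummer_ode (b / 2 + m / 4) hb (2 * Complex.I * s * w)
  rw [← hM] at kummer_equation
  simp only [radialFactor, ← hM]
  linear_combination (2 * Complex.I * s * Complex.exp (-(Complex.I * s * w))) * kummer_equation +
    Complex.exp (-(Complex.I * s * w)) * M (2 * Complex.I * s * w) * s ^ 2 * w * Complex.I_sq

/-- The factor of `Fmlk n s m l k h` that depends on `y`. -/
def solution (n : ℕ) (s : ℂ) (m : ℤ) (l k : ℕ) (h : MvPolynomial (Fin n) ℂ) :
    EuclideanSpace ℝ (Fin n) → ℂ :=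
  (radialFactor s (((m : ℂ) + 4 * l + 2 * k + n) / 4) (2 * l + k + (n : ℂ) / 2) ∘
    polyFun (normSqPoly (Fin n) ℂ)) * polyFun (normSqPoly (Fin n) ℂ ^ l * h)

variable {n : ℕ} {s : ℂ} {m : ℤ} {l k : ℕ} {h : MvPolynomial (Fin n) ℂ}

theorem Fmlk_eq_fourierTensor (s : ℂ) (m : ℤ) (l k : ℕ) (h : MvPolynomial (Fin n) ℂ) :
    Fmlk n s m l k h = fourierTensor m (solution n s m l k h) := by
  funext p
  rw [fourierTensor_apply, solution, Pi.mul_apply, Function.comp_apply, map_mul, map_pow,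
    polyFun_normSqPoly, Pi.mul_apply, Pi.pow_apply, polyFun_apply]
  simp only [Fmlk, radialFactor]
  push_cast
  ring

theorem two_mul_add_half_add_ne_zero (hn : 1 ≤ n) (l k j : ℕ) :
    2 * (l : ℂ) + k + (n : ℂ) / 2 + j ≠ 0 := by
  have : ((4 * l + 2 * k + n + 2 * j : ℕ) : ℂ) ≠ 0 := Nat.cast_ne_zero.2 (by omega)
  contrapose! this
  push_cast
  linear_combination 2 * this

theorem differentiable_solution_radialFactor (hn : 1 ≤ n) (s a : ℂ) (l k : ℕ) :
    Differentiable ℂ (radialFactor s a (2 * l + k + (n : ℂ) / 2)) :=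
  differentiable_radialFactor s a (two_mul_add_half_add_ne_zero hn l k)

theorem contDiff_solution (hn : 1 ≤ n) : ContDiff ℝ ∞ (solution n s m l k h) :=
  (contDiff_comp_polyFun (differentiable_solution_radialFactor hn s _ l k) _).mul
    (contDiff_polyFun _)

theorem isHomogeneous_normSqPoly_pow_mul (hh : h.IsHomogeneous k) (l : ℕ) :
    (normSqPoly (Fin n) ℂ ^ l * h).IsHomogeneous (2 * l + k) :=
  (isHomogeneous_normSqPoly.pow l).mul hh

theorem solution_pde (hn : 1 ≤ n) (hh : h ∈ harmonicPoly n k) (y : EuclideanSpace ℝ (Fin n)) :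
    ((‖y‖ ^ 2 : ℝ) : ℂ) * ((4 * s ^ 2 * ((‖y‖ ^ 2 : ℝ) : ℂ) - 2 * Complex.I * m * s) *
      solution n s m l k h y + Laplacian.laplacian (solution n s m l k h) y) =
    2 * ((l : ℂ) * (2 * (l : ℂ) + 2 * (k : ℂ) + (n : ℂ) - 2)) * solution n s m l k h y := by
  have parameter_eq : ((m : ℂ) + 4 * l + 2 * k + n) / 4 =
      (2 * l + k + (n : ℂ) / 2) / 2 + (m : ℂ) / 4 := by ring
  have harmonic : lapPoly (Fin n) ℂ h = 0 := (lapPoly_apply h).trans hh.2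
  have eigenvector := congrFun (congrArg polyFun
    (normSqPoly_mul_lapPoly_normSqPoly_pow_mul hh.1 harmonic l)) y
  have ode := radialFactor_ode s m ((‖y‖ ^ 2 : ℝ) : ℂ) (two_mul_add_half_add_ne_zero hn l k)
  rw [map_mul, map_smul, Pi.mul_apply, Pi.smul_apply, smul_eq_mul, polyFun_normSqPoly,
    Fintype.card_fin] at eigenvector
  rw [← parameter_eq] at ode
  have laplacian_eq := congrFun (laplacian_comp_normSqPoly_mul_polyFun
    (differentiable_solution_radialFactor hn s (((m : ℂ) + 4 * l + 2 * k + n) / 4) l k)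
    (isHomogeneous_normSqPoly_pow_mul hh.1 l)) y
  rw [solution, laplacian_eq]
  simp only [Pi.add_apply, Pi.mul_apply, Function.comp_apply, polyFun_normSqPoly,
    Pi.natCast_apply, Pi.ofNat_apply]
  push_cast at eigenvector ode ⊢
  linear_combination
    (4 * (‖y‖ : ℂ) ^ 2 * polyFun (normSqPoly (Fin n) ℂ ^ l * h) y) * ode +
      radialFactor s (((m : ℂ) + 4 * l + 2 * k + n) / 4) (2 * l + k + (n : ℂ) / 2)
        ((‖y‖ : ℂ) ^ 2) * eigenvector

theorem solution_neg (hh : h.IsHomogeneous k) (y : EuclideanSpace ℝ (Fin n)) :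
    solution n s m l k h (-y) = (-1) ^ k * solution n s m l k h y := by
  have parity := polyFun_smul_of_isHomogeneous (isHomogeneous_normSqPoly_pow_mul hh l) (-1) y
  rw [neg_one_smul, Complex.ofReal_neg, Complex.ofReal_one, pow_add, pow_mul, neg_one_sq, one_pow,
    one_mul] at parity
  simp only [solution, Pi.mul_apply, Function.comp_apply, polyFun_normSqPoly, norm_neg, parity]
  ring

theorem vanishesToOrder_solution_sub (hn : 1 ≤ n) (hh : h.IsHomogeneous k) :
    VanishesToOrder (2 * l + k + 1)
      (solution n s m l k h - polyFun (normSqPoly (Fin n) ℂ ^ l * h)) := by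
  set R := radialFactor s (((m : ℂ) + 4 * l + 2 * k + n) / 4) (2 * l + k + (n : ℂ) / 2) ∘
    polyFun (normSqPoly (Fin n) ℂ) with hR
  have smooth : ContDiff ℝ ∞ (R - 1) := (contDiff_comp_polyFun
    (differentiable_solution_radialFactor hn s _ l k) _).sub contDiff_const
  have vanishes : VanishesToOrder 1 (R - 1) :=
    (vanishesToOrder_succ_iff_partialDeriv smooth).2
      ⟨by simp [hR, polyFun_normSqPoly, radialFactor_zero], fun _ => .zero _⟩
  have factorization : solution n s m l k h - polyFun (normSqPoly (Fin n) ℂ ^ l * h) =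
      polyFun (normSqPoly (Fin n) ℂ ^ l * h) * (R - 1) := by
    rw [solution, ← hR]
    ring
  rw [factorization]
  exact (vanishesToOrder_polyFun (isHomogeneous_normSqPoly_pow_mul hh l)).mul (contDiff_polyFun _)
    smooth vanishes

theorem exists_polyFun_comp (u : EuclideanSpace ℝ (Fin n) →ₗ[ℝ] EuclideanSpace ℝ (Fin n)) {d : ℕ}
    {P : MvPolynomial (Fin n) ℂ} (hP : P.IsHomogeneous d) :
    ∃ Q : MvPolynomial (Fin n) ℂ, Q.IsHomogeneous d ∧ polyFun Q = polyFun P ∘ u := by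
  let form (i : Fin n) : MvPolynomial (Fin n) ℂ :=
    ∑ j, C ((u (EuclideanSpace.single j 1) i : ℝ) : ℂ) * X j
  have form_apply (i : Fin n) (y : EuclideanSpace ℝ (Fin n)) :
      polyFun (form i) y = ((u y i : ℝ) : ℂ) := by
    conv_rhs => rw [← (EuclideanSpace.basisFun (Fin n) ℝ).sum_repr y]
    simp [form, polyFun_apply, mul_comm]
  refine ⟨aeval form P, ?_, funext fun y => ?_⟩
  · simpa using hP.aeval form fun i => IsHomogeneous.sum _ _ _ fun j _ => isHomogeneous_C_mul_X _ _
  · simp only [Function.comp_apply, polyFun_apply, ← aeval_eq_eval, comp_aeval_apply]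
      at form_apply ⊢
    simp only [form_apply]

theorem finiteDimensional_rotationSpan_solution (hh : h.IsHomogeneous k) :
    FiniteDimensional ℂ (rotationSpan (solution n s m l k h)) := by
  let mulRadial : homogeneousSubmodule (Fin n) ℂ (2 * l + k) →ₗ[ℂ]
      EuclideanSpace ℝ (Fin n) → ℂ :=
    LinearMap.mulLeft ℂ (radialFactor s (((m : ℂ) + 4 * l + 2 * k + n) / 4)
      (2 * l + k + (n : ℂ) / 2) ∘ polyFun (normSqPoly (Fin n) ℂ)) ∘ₗ
      polyFun.toLinearMap ∘ₗ Submodule.subtype _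
  have : FiniteDimensional ℂ (homogeneousSubmodule (Fin n) ℂ (2 * l + k)) :=
    Module.Finite.iff_fg.2 (homogeneousSubmodule_fg _ _ _)
  refine Submodule.finiteDimensional_of_le (S₂ := LinearMap.range mulRadial)
    (Submodule.span_le.2 (Set.range_subset_iff.2 fun u => ?_))
  obtain ⟨Q, hQ, hQu⟩ := exists_polyFun_comp u.toLinearEquiv.toLinearMap
    (isHomogeneous_normSqPoly_pow_mul hh l)
  refine ⟨⟨Q, hQ⟩, funext fun y => ?_⟩
  simp [mulRadial, hQu, solution, polyFun_normSqPoly]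

theorem Fmlk_mem_kerOmegaK {q : ZMod 4} {lam : ℂ} (hn : 1 ≤ n) (hpair : IsAdmissiblePair n lam l k)
    (hh : h ∈ harmonicPoly n k) (hm : (m : ZMod 4) = 2 * (k : ZMod 4) + q) :
    Fmlk n s m l k h ∈ kerOmegaK n q s lam := by
  rw [Fmlk_eq_fourierTensor]
  refine ⟨⟨fourierTensor_mem_compactPicture_iff.2 ⟨contDiff_solution hn, fun y => ?_⟩, ?_⟩,
    (isKFinite_fourierTensor_iff m _).2 (finiteDimensional_rotationSpan_solution hh.1)⟩
  · rw [(I_zpow_sub_val_eq_neg_one_pow_iff m q k).2 hm, solution_neg hh.1]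
  · rw [OmegaOp_fourierTensor s m (contDiff_solution hn), ← map_smul]
    congr 1
    funext y
    rw [solution_pde hn hh, ← hpair.1, Pi.smul_apply, smul_eq_mul]

end Solutions

section LeadingTerm

open MvPolynomial

variable {n N : ℕ} {f : EuclideanSpace ℝ (Fin n) → ℂ} {P : MvPolynomial (Fin n) ℂ}

theorem normSqPoly_mul_lapPoly_eq_smul_of_pde {V : EuclideanSpace ℝ (Fin n) → ℂ} {μ : ℂ}
    (hV : ContDiff ℝ ∞ V) (hf : ContDiff ℝ ∞ f)
    (pde : ∀ y, ((‖y‖ ^ 2 : ℝ) : ℂ) * (V y * f y + Laplacian.laplacian f y) = μ * f y)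
    (hfN : VanishesToOrder N f) (hP : P.IsHomogeneous N)
    (hPf : VanishesToOrder (N + 1) (f - polyFun P)) :
    normSqPoly (Fin n) ℂ * lapPoly (Fin n) ℂ P = μ • P := by
  set g := f - polyFun P with hg
  set ρ := polyFun (normSqPoly (Fin n) ℂ) with hρ
  have g_smooth : ContDiff ℝ ∞ g := hf.sub (contDiff_polyFun P)
  have ρ_smooth : ContDiff ℝ ∞ ρ := contDiff_polyFun _
  have Δg_smooth := contDiff_laplacian g_smooth
  have ρ_order : VanishesToOrder 2 ρ := vanishesToOrder_polyFun isHomogeneous_normSqPoly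
  have defect_eq : polyFun (normSqPoly (Fin n) ℂ * lapPoly (Fin n) ℂ P - μ • P) =
      μ • g - ρ * Laplacian.laplacian g - ρ * (V * f) := by
    funext y
    have laplacian_g : Laplacian.laplacian (f - polyFun P) y =
        Laplacian.laplacian f y - polyFun (lapPoly (Fin n) ℂ P) y := by
      rw [ContDiffAt.laplacian_sub (contDiff_infty.1 hf 2).contDiffAt
        (contDiff_infty.1 (contDiff_polyFun P) 2).contDiffAt, laplacian_polyFun]
    simp only [hg, hρ, map_sub, map_mul, map_smul, Pi.sub_apply, Pi.mul_apply, Pi.smul_apply,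
      smul_eq_mul, laplacian_g, polyFun_normSqPoly] at pde ⊢
    linear_combination pde y
  have ρ_mul_laplacian_order : VanishesToOrder (N + 1) (ρ * Laplacian.laplacian g) := by
    rcases N with _ | N
    · exact (ρ_order.mul ρ_smooth Δg_smooth (.zero _)).mono (by omega)
    · exact (ρ_order.mul ρ_smooth Δg_smooth (hPf.laplacian g_smooth)).mono (by omega)
  have ρ_mul_potential_order : VanishesToOrder (N + 1) (ρ * (V * f)) :=
    (ρ_order.mul ρ_smooth (hV.mul hf) (VanishesToOrder.mul hV hf (.zero V) hfN)).mono (by omega)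
  refine sub_eq_zero.1 (eq_zero_of_vanishesToOrder
    ((isHomogeneous_normSqPoly_mul_lapPoly hP).sub
      ((homogeneousSubmodule _ _ _).smul_mem μ hP)) ?_)
  rw [defect_eq]
  have μg_smooth : ContDiff ℝ ∞ (μ • g) := contDiff_const.smul g_smooth
  exact .sub (μg_smooth.sub (ρ_smooth.mul Δg_smooth)) (ρ_smooth.mul (hV.mul hf))
    (.sub μg_smooth (ρ_smooth.mul Δg_smooth) (hPf.const_smul μ g_smooth) ρ_mul_laplacian_order)
    ρ_mul_potential_order

theorem eq_neg_one_pow_of_leading {c : ℂ} (hf : ContDiff ℝ ∞ f) (parity : ∀ y, f (-y) = c * f y)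
    (hP : P.IsHomogeneous N) (hP₀ : P ≠ 0) (hPf : VanishesToOrder (N + 1) (f - polyFun P)) :
    c = (-1) ^ N := by
  set g := f - polyFun P with hg
  have g_smooth : ContDiff ℝ ∞ g := hf.sub (contDiff_polyFun P)
  have parity_defect : polyFun (((-1) ^ N - c) • P) = c • g - fun y => g (-y) := by
    funext y
    have polyFun_neg := polyFun_smul_of_isHomogeneous hP (-1) y
    rw [neg_one_smul] at polyFun_neg
    push_cast at polyFun_neg
    simp only [hg, map_smul, Pi.smul_apply, Pi.sub_apply, smul_eq_mul, parity, polyFun_neg]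
    ring
  have defect_eq_zero : ((-1) ^ N - c) • P = 0 := by
    refine eq_zero_of_vanishesToOrder ((homogeneousSubmodule _ _ _).smul_mem _ hP) ?_
    rw [parity_defect]
    exact .sub (contDiff_const.smul g_smooth) (g_smooth.comp contDiff_neg)
      (hPf.const_smul c g_smooth) hPf.comp_neg
  exact (sub_eq_zero.1 ((smul_eq_zero.1 defect_eq_zero).resolve_right hP₀)).symm

end LeadingTerm

section WeightSpaces

variable {n N k l : ℕ} {f : EuclideanSpace ℝ (Fin n) → ℂ} {q : ZMod 4} {s lam : ℂ} {m : ℤ}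

theorem contDiff_of_fourierTensor_mem (hf : fourierTensor m f ∈ kerOmegaK n q s lam) :
    ContDiff ℝ ∞ f :=
  contDiff_fourierTensor_iff.1 hf.1.1.1

theorem neg_apply_of_fourierTensor_mem (hf : fourierTensor m f ∈ kerOmegaK n q s lam)
    (y : EuclideanSpace ℝ (Fin n)) : f (-y) = Complex.I ^ (m - (q.val : ℤ)) * f y :=
  (fourierTensor_mem_compactPicture_iff.1 hf.1.1).2 y

theorem pde_of_fourierTensor_mem (hf : fourierTensor m f ∈ kerOmegaK n q s lam)
    (y : EuclideanSpace ℝ (Fin n)) :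
    ((‖y‖ ^ 2 : ℝ) : ℂ) * ((4 * s ^ 2 * ((‖y‖ ^ 2 : ℝ) : ℂ) - 2 * Complex.I * m * s) * f y +
      Laplacian.laplacian f y) = 2 * lam * f y := by
  have eigen := hf.1.2
  rw [OmegaOp_fourierTensor s m (contDiff_of_fourierTensor_mem hf), ← map_smul] at eigen
  exact congrFun (fourierTensor_injective m eigen) y

theorem fourierTensor_mem_of_mem_rotationSpan (hf : fourierTensor m f ∈ kerOmegaK n q s lam)
    {g : EuclideanSpace ℝ (Fin n) → ℂ} (hg : g ∈ rotationSpan f) :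
    fourierTensor m g ∈ kerOmegaK n q s lam := by
  refine kSpan_le_kerOmegaK hf ?_
  rw [kSpan_fourierTensor]
  exact Submodule.mem_map_of_mem hg

theorem comp_isometry_mem_rotationSpan {g : EuclideanSpace ℝ (Fin n) → ℂ} (hg : g ∈ rotationSpan f)
    (u : EuclideanSpace ℝ (Fin n) ≃ₗᵢ[ℝ] EuclideanSpace ℝ (Fin n)) : g ∘ u ∈ rotationSpan f := by
  suffices rotationSpan f ≤ (rotationSpan f).comap (LinearMap.funLeft ℂ ℂ u) from this hg
  refine Submodule.span_le.2 ?_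
  rintro _ ⟨v, rfl⟩
  exact Submodule.subset_span ⟨u.trans v, rfl⟩

theorem VanishesToOrder.of_mem_rotationSpan (hf : ContDiff ℝ ∞ f) (hfN : VanishesToOrder N f)
    {g : EuclideanSpace ℝ (Fin n) → ℂ} (hg : g ∈ rotationSpan f) : VanishesToOrder N g := by
  suffices ContDiff ℝ ∞ g ∧ VanishesToOrder N g from this.2
  induction hg using Submodule.span_induction with
  | mem g hg =>
    obtain ⟨u, rfl⟩ := hg
    exact ⟨hf.comp u.contDiff, hfN.comp_isometry u⟩
  | zero => exact ⟨contDiff_const, by simpa using hfN.const_smul 0 hf⟩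
  | add g h _ _ hg hh => exact ⟨hg.1.add hh.1, hg.2.add hg.1 hh.1 hh.2⟩
  | smul c g _ hg => exact ⟨contDiff_const.smul hg.1, hg.2.const_smul c hg.1⟩

theorem eq_zero_of_fourierTensor_mem_of_flat (hf : fourierTensor m f ∈ kerOmegaK n q s lam)
    (flat : ∀ N, VanishesToOrder N f) : f = 0 := by
  have : FiniteDimensional ℂ (rotationSpan f) := (isKFinite_fourierTensor_iff m f).1 hf.2
  have hf_smooth := contDiff_of_fourierTensor_mem hf
  refine eq_zero_of_flat (W := rotationSpan f)
    (V := fun r => 2 * lam - (r : ℂ) ^ 2 * (4 * s ^ 2 * (r : ℂ) ^ 2 - 2 * Complex.I * m * s))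
    (fun g hg => comp_isometry_mem_rotationSpan hg)
    (fun g hg => contDiff_of_fourierTensor_mem (fourierTensor_mem_of_mem_rotationSpan hf hg))
    (fun g hg N => (flat N).of_mem_rotationSpan hf_smooth hg) (by fun_prop) (fun g hg y => ?_)
    (Submodule.subset_span ⟨LinearIsometryEquiv.refl ℝ _, rfl⟩)
  have pde := pde_of_fourierTensor_mem (fourierTensor_mem_of_mem_rotationSpan hf hg) y
  rw [Complex.real_smul]
  push_cast at pde ⊢
  linear_combination pde

theorem le_one_of_mem_harmonicPoly_one {h : MvPolynomial (Fin 1) ℂ} (hh : h ∈ harmonicPoly 1 k)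
    (h₀ : h ≠ 0) : k ≤ 1 := by
  by_contra! hk
  obtain ⟨homogeneous, harmonic⟩ := hh
  have euler := homogeneous.sum_X_mul_pderiv
  have euler_pderiv := (homogeneous.pderiv (i := 0)).sum_X_mul_pderiv
  simp only [Fin.sum_univ_one] at harmonic euler euler_pderiv
  rw [harmonic, mul_zero, eq_comm, smul_eq_zero] at euler_pderiv
  rw [euler_pderiv.resolve_left (by omega), mul_zero, eq_comm, smul_eq_zero] at euler
  exact euler.elim (by omega) h₀

theorem exists_leading_solution (hn : 1 ≤ n) (hlam : 2 ≤ n → lam ≠ 0)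
    (hf : fourierTensor m f ∈ kerOmegaK n q s lam) (hfN : VanishesToOrder N f)
    (hfN' : ¬ VanishesToOrder (N + 1) f) :
    ∃ (l k : ℕ) (h : MvPolynomial (Fin n) ℂ), N = 2 * l + k ∧ IsAdmissiblePair n lam l k ∧
      h ∈ harmonicPoly n k ∧ (m : ZMod 4) = 2 * (k : ZMod 4) + q ∧
      VanishesToOrder (N + 1) (f - solution n s m l k h) := by
  have : Nonempty (Fin n) := ⟨⟨0, hn⟩⟩
  have hf_smooth := contDiff_of_fourierTensor_mem hf
  obtain ⟨P, hP, hPf⟩ := exists_leading_polynomial hf_smooth hfN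
  have hP₀ : P ≠ 0 := by
    rintro rfl
    exact hfN' (by simpa using hPf)
  have potential_smooth : ContDiff ℝ ∞ fun y : EuclideanSpace ℝ (Fin n) =>
      4 * s ^ 2 * ((‖y‖ ^ 2 : ℝ) : ℂ) - 2 * Complex.I * m * s :=
    (contDiff_const.mul (Complex.ofRealCLM.contDiff.comp (contDiff_norm_sq ℝ))).sub contDiff_const
  obtain ⟨l, k, h, rfl, hh, harmonic, rfl, eigenvalue_eq⟩ :=
    exists_eq_normSqPoly_pow_mul hP hP₀ (normSqPoly_mul_lapPoly_eq_smul_of_pde potential_smooth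
      hf_smooth (pde_of_fourierTensor_mem hf) hfN hP hPf)
  rw [Fintype.card_fin] at eigenvalue_eq
  have lam_eq := mul_left_cancel₀ two_ne_zero eigenvalue_eq
  have hh_mem : h ∈ harmonicPoly n k := ⟨hh, (lapPoly_apply h).symm.trans harmonic⟩
  refine ⟨l, k, h, rfl, ⟨lam_eq, fun hn₂ => Nat.one_le_iff_ne_zero.2 ?_, ?_⟩, hh_mem, ?_, ?_⟩
  · rintro rfl
    exact hlam hn₂ (by simpa using lam_eq)
  · rintro rfl
    exact le_one_of_mem_harmonicPoly_one hh_mem (right_ne_zero_of_mul hP₀)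
  · rw [← I_zpow_sub_val_eq_neg_one_pow_iff,
      eq_neg_one_pow_of_leading hf_smooth (neg_apply_of_fourierTensor_mem hf) hP hP₀ hPf, pow_add,
      pow_mul, neg_one_sq, one_pow, one_mul]
  · rw [← sub_sub_sub_cancel_right f _ (polyFun (normSqPoly (Fin n) ℂ ^ l * h))]
    exact hPf.sub (hf_smooth.sub (contDiff_polyFun _))
      ((contDiff_solution hn).sub (contDiff_polyFun _)) (vanishesToOrder_solution_sub hn hh)

end WeightSpaces

section Span

variable {n N k l : ℕ} {f : EuclideanSpace ℝ (Fin n) → ℂ} {q : ZMod 4} {s lam : ℂ} {m : ℤ}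

theorem degree_le_of_isAdmissiblePair (hn : 1 ≤ n) (h : IsAdmissiblePair n lam l k) :
    2 * (l : ℝ) + k ≤ ‖lam‖ + 1 := by
  obtain ⟨lam_eq, one_le_l, k_le_one⟩ := h
  rcases Nat.eq_zero_or_pos l with rfl | hl
  · have hk : (k : ℝ) ≤ 1 := mod_cast k_le_one (by omega)
    simpa using hk.trans (le_add_of_nonneg_left (norm_nonneg lam))
  have le_norm : (l : ℝ) * (2 * l + 2 * k + n - 2) ≤ ‖lam‖ := by
    have lam_real : lam = ((l * (2 * l + 2 * k + n - 2) : ℝ) : ℂ) := by simpa using lam_eq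
    rw [lam_real, Complex.norm_real]
    exact le_abs_self _
  have hl₁ : (1 : ℝ) ≤ l := mod_cast hl
  have hn₁ : (1 : ℝ) ≤ n := mod_cast hn
  nlinarith [mul_nonneg (sub_nonneg.2 hl₁) (Nat.cast_nonneg (α := ℝ) k),
    mul_nonneg (sub_nonneg.2 hl₁) (sub_nonneg.2 hn₁)]

theorem eq_zero_of_forall_degree_lt (hn : 1 ≤ n) (hlam : 2 ≤ n → lam ≠ 0)
    (hf : fourierTensor m f ∈ kerOmegaK n q s lam) (hfN : VanishesToOrder N f)
    (degree_lt : ∀ l k, IsAdmissiblePair n lam l k → 2 * l + k < N) : f = 0 := by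
  have vanishes (j : ℕ) : VanishesToOrder (N + j) f := by
    induction j with
    | zero => exact hfN
    | succ j ih =>
      by_contra not_vanishes
      obtain ⟨l, k, -, degree_eq, hpair, -⟩ := exists_leading_solution hn hlam hf ih not_vanishes
      have := degree_lt l k hpair
      omega
  exact eq_zero_of_fourierTensor_mem_of_flat hf fun M => (vanishes M).mono (by omega)

/-- The functions `F_{m,l,k}` with `(l, k)` a `λ`-admissible pair, `h` a harmonic polynomial of
degree `k` and `m ≡ 2k + q` modulo `4`. -/
def generators (n : ℕ) (q : ZMod 4) (s lam : ℂ) : Set (Fn n) :=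
  {F | ∃ (m : ℤ) (l k : ℕ) (h : MvPolynomial (Fin n) ℂ), IsAdmissiblePair n lam l k ∧
    h ∈ harmonicPoly n k ∧ (m : ZMod 4) = 2 * (k : ZMod 4) + q ∧ F = Fmlk n s m l k h}

theorem fourierTensor_mem_span_generators (hn : 1 ≤ n) (hlam : 2 ≤ n → lam ≠ 0) {d : ℕ}
    (degree_lt : ∀ l k, IsAdmissiblePair n lam l k → 2 * l + k < N + d)
    (hf : fourierTensor m f ∈ kerOmegaK n q s lam) (hfN : VanishesToOrder N f) :
    fourierTensor m f ∈ Submodule.span ℂ (generators n q s lam) := by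
  induction d generalizing N f with
  | zero => simp [eq_zero_of_forall_degree_lt hn hlam hf hfN degree_lt]
  | succ d ih =>
    have degree_lt' (l k : ℕ) (h : IsAdmissiblePair n lam l k) : 2 * l + k < N + 1 + d := by
      have := degree_lt l k h
      omega
    by_cases hfN' : VanishesToOrder (N + 1) f
    · exact ih degree_lt' hf hfN'
    obtain ⟨l, k, h, -, hpair, hh, hm, remainder_vanishes⟩ :=
      exists_leading_solution hn hlam hf hfN hfN'
    have solution_mem_span : fourierTensor m (solution n s m l k h) ∈
        Submodule.span ℂ (generators n q s lam) :=
      Submodule.subset_span ⟨m, l, k, h, hpair, hh, hm, (Fmlk_eq_fourierTensor s m l k h).symm⟩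
    have remainder_mem : fourierTensor m (f - solution n s m l k h) ∈ kerOmegaK n q s lam := by
      rw [map_sub, ← Fmlk_eq_fourierTensor]
      exact Submodule.sub_mem _ hf (Fmlk_mem_kerOmegaK hn hpair hh hm)
    simpa using Submodule.add_mem _ (ih degree_lt' remainder_mem remainder_vanishes)
      solution_mem_span

theorem kerOmegaK_eq_span_generators (hn : 1 ≤ n) (hlam : 2 ≤ n → lam ≠ 0) :
    kerOmegaK n q s lam = Submodule.span ℂ (generators n q s lam) := by
  refine le_antisymm (kerOmegaK_le_of_fourierTensor_mem fun m f hf => ?_) (Submodule.span_le.2 ?_)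
  · obtain ⟨d, hd⟩ := exists_nat_gt (‖lam‖ + 1)
    refine fourierTensor_mem_span_generators hn hlam (d := d) (fun l k hpair => ?_) hf (.zero f)
    rw [zero_add]
    exact_mod_cast (degree_le_of_isAdmissiblePair hn hpair).trans_lt hd
  · rintro _ ⟨m, l, k, h, hpair, hh, hm, rfl⟩
    exact Fmlk_mem_kerOmegaK hn hpair hh hm

end Span

section Nontriviality

open MvPolynomial

variable {n k l : ℕ} {lam : ℂ}

theorem Fmlk_ne_zero (hn : 1 ≤ n) (s : ℂ) (m : ℤ) (l : ℕ) {h : MvPolynomial (Fin n) ℂ}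
    (hh : h.IsHomogeneous k) (h₀ : h ≠ 0) : Fmlk n s m l k h ≠ 0 := by
  have : Nonempty (Fin n) := ⟨⟨0, hn⟩⟩
  intro Fmlk_eq_zero
  have solution_eq_zero : solution n s m l k h = 0 :=
    fourierTensor_injective m (by rw [← Fmlk_eq_fourierTensor, Fmlk_eq_zero, map_zero])
  have leading_vanishes := vanishesToOrder_solution_sub (s := s) (m := m) (l := l) hn hh
  rw [solution_eq_zero, zero_sub, ← map_neg] at leading_vanishes
  exact neg_ne_zero.2 (mul_ne_zero (pow_ne_zero l normSqPoly_ne_zero) h₀)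
    (eq_zero_of_vanishesToOrder (isHomogeneous_normSqPoly_pow_mul hh l).neg leading_vanishes)

theorem isotropic_pow_mem_harmonicPoly {a : Fin n → ℂ} (ha : ∑ i, a i ^ 2 = 0) (k : ℕ) :
    (∑ i, C (a i) * X i) ^ k ∈ harmonicPoly n k := by
  classical
  set z : MvPolynomial (Fin n) ℂ := ∑ i, C (a i) * X i with hz
  have z_homogeneous : z.IsHomogeneous 1 :=
    .sum _ _ _ fun i _ => isHomogeneous_C_mul_X (a i) i
  have pderiv_z (i : Fin n) : pderiv i z = C (a i) := by
    simp [hz, pderiv_X, Pi.single_apply]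
  have pderiv_pderiv_pow (i : Fin n) : pderiv i (pderiv i (z ^ k)) =
      (k : MvPolynomial (Fin n) ℂ) * ((k - 1 : ℕ) : MvPolynomial (Fin n) ℂ) * z ^ (k - 1 - 1) *
        C (a i ^ 2) := by
    simp only [Derivation.leibniz_pow, pderiv_z, Derivation.leibniz, Derivation.map_natCast,
      pderiv_C, smul_eq_mul, nsmul_eq_mul, map_pow]
    ring
  refine ⟨by simpa using z_homogeneous.pow k, ?_⟩
  simp only [pderiv_pderiv_pow, ← Finset.mul_sum, ← map_sum, ha, map_zero, mul_zero]

theorem exists_mem_harmonicPoly_ne_zero_of_two_le (hn : 2 ≤ n) (k : ℕ) :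
    ∃ h ∈ harmonicPoly n k, h ≠ 0 := by
  obtain ⟨n, rfl⟩ := Nat.exists_eq_add_of_le' hn
  let a : Fin (n + 2) → ℂ := Fin.cons 1 (Fin.cons Complex.I 0)
  have isotropic : ∑ i, a i ^ 2 = 0 := by simp [a, Fin.sum_univ_succ]
  refine ⟨_, isotropic_pow_mem_harmonicPoly isotropic k, pow_ne_zero k fun form_eq_zero => ?_⟩
  have eval_eq_zero := congrArg (eval (Pi.single 0 (1 : ℂ))) form_eq_zero
  simp [a, Fin.sum_univ_succ] at eval_eq_zero

theorem exists_mem_harmonicPoly_ne_zero_of_le_one (hn : 1 ≤ n) (hk : k ≤ 1) :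
    ∃ h ∈ harmonicPoly n k, h ≠ 0 := by
  have lapPoly_eq_zero {h : MvPolynomial (Fin n) ℂ} (hh : h.IsHomogeneous k) :
      ∑ i, pderiv i (pderiv i h) = 0 :=
    (lapPoly_apply h).symm.trans (lapPoly_eq_zero_of_lt_two hh (by omega))
  interval_cases k
  · exact ⟨1, ⟨isHomogeneous_one _ _, lapPoly_eq_zero (isHomogeneous_one _ _)⟩, one_ne_zero⟩
  · exact ⟨X ⟨0, hn⟩, ⟨isHomogeneous_X _ _, lapPoly_eq_zero (isHomogeneous_X _ _)⟩, X_ne_zero _⟩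

theorem exists_mem_harmonicPoly_ne_zero (hn : 1 ≤ n) (hk : n = 1 → k ≤ 1) :
    ∃ h ∈ harmonicPoly n k, h ≠ 0 := by
  rcases hn.eq_or_lt with rfl | hn₂
  · exact exists_mem_harmonicPoly_ne_zero_of_le_one le_rfl (hk rfl)
  · exact exists_mem_harmonicPoly_ne_zero_of_two_le hn₂ k

theorem mem_admissibleSet_of_isAdmissiblePair (hn : 1 ≤ n) (h : IsAdmissiblePair n lam l k) :
    lam ∈ admissibleSet n := by
  obtain ⟨rfl, one_le_l, k_le_one⟩ := h
  unfold admissibleSet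
  split_ifs with hn₁
  · refine ⟨2 * l + k, ?_⟩
    have := k_le_one hn₁
    subst hn₁
    interval_cases k <;> push_cast <;> ring
  · have := one_le_l (by omega)
    refine ⟨l, l + k - 1, by omega, by omega, ?_⟩
    push_cast
    ring

theorem exists_isAdmissiblePair_of_mem_admissibleSet (h : lam ∈ admissibleSet n) :
    ∃ l k, IsAdmissiblePair n lam l k := by
  unfold admissibleSet at h
  split_ifs at h with hn₁
  · obtain ⟨L, rfl⟩ := h
    subst hn₁
    refine ⟨L / 2, L % 2, ?_, by omega, fun _ => by omega⟩
    obtain ⟨j, rfl | rfl⟩ := L.even_or_odd'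
    · simp only [Nat.mul_div_cancel_left j two_pos, Nat.mul_mod_right]
      push_cast
      ring
    · rw [show (2 * j + 1) / 2 = j by omega, show (2 * j + 1) % 2 = 1 by omega]
      push_cast
      ring
  · obtain ⟨l, j, hl, hlj, rfl⟩ := h
    lift l to ℕ using by omega
    obtain ⟨k, hk⟩ := Int.le.dest hlj
    refine ⟨l, k, ?_, fun _ => by omega, fun h => absurd h hn₁⟩
    have hj : (j : ℂ) = l + k - 1 :=
      mod_cast congrArg (Int.cast (R := ℂ)) (eq_sub_of_add_eq hk.symm)
    rw [hj]
    push_cast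
    ring

end Nontriviality

end SingularSchrodinger

end

theorem mainTheorem2 (n : ℕ) (hn : 1 ≤ n) (q : ZMod 4) (s lam : ℂ)
    (hlam : 2 ≤ n → lam ≠ 0) :
    (SingularSchrodinger.kerOmegaK n q s lam ≠ ⊥ ↔
      lam ∈ SingularSchrodinger.admissibleSet n) ∧
    (lam ∈ SingularSchrodinger.admissibleSet n →
      SingularSchrodinger.kerOmegaK n q s lam =
        Submodule.span ℂ {F : SingularSchrodinger.Fn n |
          ∃ (m : ℤ) (l k : ℕ) (h : MvPolynomial (Fin n) ℂ),
            SingularSchrodinger.IsAdmissiblePair n lam l k ∧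
            h ∈ SingularSchrodinger.harmonicPoly n k ∧
            (m : ZMod 4) = 2 * (k : ZMod 4) + q ∧
            F = SingularSchrodinger.Fmlk n s m l k h}) := by
  have span_eq := SingularSchrodinger.kerOmegaK_eq_span_generators (q := q) (s := s) hn hlam
  refine ⟨⟨fun ker_ne_bot => ?_, fun admissible ker_eq_bot => ?_⟩, fun _ => span_eq⟩
  · rw [span_eq, Ne, Submodule.span_eq_bot] at ker_ne_bot
    push Not at ker_ne_bot
    obtain ⟨_, ⟨m, l, k, h, hpair, -⟩, -⟩ := ker_ne_bot
    exact SingularSchrodinger.mem_admissibleSet_of_isAdmissiblePair hn hpair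
  · obtain ⟨l, k, hpair⟩ :=
      SingularSchrodinger.exists_isAdmissiblePair_of_mem_admissibleSet admissible
    obtain ⟨h, hh, h₀⟩ := SingularSchrodinger.exists_mem_harmonicPoly_ne_zero hn hpair.2.2
    have hm : ((2 * k + q.val : ℤ) : ZMod 4) = 2 * (k : ZMod 4) + q := by simp
    have Fmlk_mem := SingularSchrodinger.Fmlk_mem_kerOmegaK (s := s) hn hpair hh hm
    rw [ker_eq_bot, Submodule.mem_bot] at Fmlk_mem
    exact SingularSchrodinger.Fmlk_ne_zero hn s _ l hh.1 h₀ Fmlk_mem
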